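/- Let $\Bbbk$ be a field, let $q\in\Bbbk[x,y]$ be a nonzero homogeneous form of degree $2$, and let $R=\Bbbk[x,y]/\langle q\rangle$ with the standard grading. For a finitely generated $\mathbb Z$-graded $R$-module $M$ with minimal graded free resolution $F_0\leftarrow F_1\leftarrow\cdots$, $F_i=\bigoplus_{j\in\mathbb Z}R(-j)^{\beta_{i,j}(M)}$, let $\beta(M)=(\beta_{i,j}(M))_{i\ge 0,\,j\in\mathbb Z}$ be its Betti diagram, an element of the $\mathbb Q$-vector space $\mathbb V$ of column-finite rational matrices (with columns indexed by $i$), and let $B_{\mathbb Q}(R)\subseteq\mathbb V$ be the cone of all finite $\mathbb Q_{\ge 0}$-linear combinations of Betti diagrams of such modules. An extremal ray of $B_{\mathbb Q}(R)$ is a ray $\mathbb Q_{\ge0}v$, $v\ne0$, that is a face of $B_{\mathbb Q}(R)$. The resolution of $M\neq 0$ is pure of type $(d_0,d_1,d_2,\dots)$, with $d_0\in\mathbb Z$ and $d_i\in\mathbb Z\cup\{\infty\}$ for $i\ge1$, if for every $i$ either $d_i\in\mathbb Z$ and $F_i\cong R(-d_i)^{b_i}$ with $b_i>0$, or $d_i=\infty$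 and $F_i=0$. Consider two kinds of modules $M$: (1) Cohen–Macaulay modules of finite projective dimension having a pure resolution of type $(d_0,d_1,\infty,\infty,\dots)$ with $d_0\in\mathbb Z$ and $d_0<d_1\le\infty$; (2) finite length modules of infinite projective dimension having a pure resolution of type $(d_0,d_1,d_1+1,d_1+2,\dots)$ with integers $d_0<d_1$. Then the extremal rays of $B_{\mathbb Q}(R)$ are exactly the rays in $\mathbb V$ spanned by the Betti diagrams of the modules of kind (1), together with the rays spanned by the Betti diagrams of those modules of kind (2) that satisfy $\beta_{1,d_1}(M)=2\beta_{0,d_0}(M)$; a module of kind (2) that does not satisfy this equality does not span an extremal ray. Every degree sequence in (1) occurs for a module of kind (1), and every degree sequence in (2) occurs for a module of kind (2) with $\beta_{1,d_1}(M)=2\beta_{0,d_0}(M)$. Moreover, $B_{\mathbb Q}(R)$ is generated as a cone by its extremal rays. -/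

import Mathlib

universe u

/-- The space `𝕍` of column-finite rational matrices, with columns indexed by the homological
degree `i : ℕ` and, in each column, entries indexed by the internal degree `j : ℤ`. -/
abbrev DiagramSpace : Type := ℕ → (ℤ →₀ ℚ)

section Ring

variable {k : Type u} [Field k]

/-- The ring `R = k[x,y]/⟨q⟩`. -/
abbrev QuadricRing (q : MvPolynomial (Fin 2) k) : Type u :=
  MvPolynomial (Fin 2) k ⧸ Ideal.span {q}

/-- The degree `n` part `Rₙ` of `R` in the standard grading (zero if `n < 0`): the image of the
forms of degree `n`. -/
noncomputable def gradedPiece (q : MvPolynomial (Fin 2) k) (n : ℤ) :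
    Submodule k (QuadricRing q) :=
  if 0 ≤ n then
    (MvPolynomial.homogeneousSubmodule (Fin 2) k n.toNat).map
      (Ideal.Quotient.mkₐ k (Ideal.span {q})).toLinearMap
  else ⊥

/-- The homogeneous maximal ideal `⟨x, y⟩` of `R`. -/
noncomputable def irrelevantIdeal (q : MvPolynomial (Fin 2) k) : Ideal (QuadricRing q) :=
  Ideal.span (Set.range fun i : Fin 2 => Ideal.Quotient.mk (Ideal.span {q}) (MvPolynomial.X i))

/-- A finitely generated `ℤ`-graded `R`-module. -/
structure GradedMod (q : MvPolynomial (Fin 2) k) : Type (u + 1) where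
  /-- the underlying module -/
  carrier : Type u
  [addCommGroup : AddCommGroup carrier]
  [module : Module (QuadricRing q) carrier]
  [finite : Module.Finite (QuadricRing q) carrier]
  /-- the graded components -/
  piece : ℤ → AddSubgroup carrier
  isInternal : DirectSum.IsInternal piece
  smul_mem : ∀ (m n : ℤ) (r : QuadricRing q) (x : carrier),
    r ∈ gradedPiece q m → x ∈ piece n → r • x ∈ piece (m + n)

attribute [instance] GradedMod.addCommGroup GradedMod.module GradedMod.finite

/-- A minimal graded free resolution `M ← F₀ ← F₁ ← ⋯` of `M`, with
`Fᵢ = ⨁ₐ R(-deg i a)` a free module on `rank i` generators, the `a`-th one in degree `deg i a`.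
All maps are homogeneous of degree `0`, and the entries of the matrices of the differentials lie
in the homogeneous maximal ideal. -/
structure MinimalResolution {q : MvPolynomial (Fin 2) k} (M : GradedMod q) where
  /-- the rank of `Fᵢ` -/
  rank : ℕ → ℕ
  /-- the degrees of the generators of `Fᵢ` -/
  deg : ∀ i, Fin (rank i) → ℤ
  /-- the augmentation `F₀ → M` -/
  aug : (Fin (rank 0) → QuadricRing q) →ₗ[QuadricRing q] M.carrier
  /-- the differential `Fᵢ₊₁ → Fᵢ` -/
  diff : ∀ i, (Fin (rank (i + 1)) → QuadricRing q) →ₗ[QuadricRing q]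
    (Fin (rank i) → QuadricRing q)
  aug_homogeneous : ∀ a, aug (Pi.single a 1) ∈ M.piece (deg 0 a)
  diff_homogeneous : ∀ i a b,
    diff i (Pi.single a 1) b ∈ gradedPiece q (deg (i + 1) a - deg i b)
  aug_surjective : Function.Surjective aug
  exact_zero : Function.Exact (diff 0) aug
  exact_succ : ∀ i, Function.Exact (diff (i + 1)) (diff i)
  minimal : ∀ i a b, diff i (Pi.single a 1) b ∈ irrelevantIdeal q

namespace MinimalResolution

variable {q : MvPolynomial (Fin 2) k} {M : GradedMod q} (F : MinimalResolution M)

/-- The Betti diagram of `M`, read off from its minimal graded free resolution: the entry at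
`(i, j)` is the number of generators of `Fᵢ` of degree `j`. -/
noncomputable def betti : DiagramSpace :=
  fun i => ∑ a : Fin (F.rank i), Finsupp.single (F.deg i a) 1

/-- The resolution is pure with degree sequence `d`: the generators of `Fᵢ` all have degree
`d i`, where `d i = ∞` means exactly that `Fᵢ = 0`. -/
def IsPure (d : ℕ → WithTop ℤ) : Prop :=
  (∀ i a, (F.deg i a : WithTop ℤ) = d i) ∧ ∀ i, F.rank i = 0 ↔ d i = ⊤

end MinimalResolution

/-- The degree sequence `(d₀, d₁, ∞, ∞, …)`. -/
def finiteType (d₀ : ℤ) (d₁ : WithTop ℤ) : ℕ → WithTop ℤ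
  | 0 => d₀
  | 1 => d₁
  | _ + 2 => ⊤

/-- The degree sequence `(d₀, d₁, d₁ + 1, d₁ + 2, …)`. -/
def infiniteType (d₀ d₁ : ℤ) : ℕ → WithTop ℤ
  | 0 => d₀
  | i + 1 => ((d₁ + i : ℤ) : WithTop ℤ)

namespace GradedMod

variable {q : MvPolynomial (Fin 2) k} (M : GradedMod q)

/-- `M` has finite projective dimension over `R`. -/
def HasFiniteProjDim : Prop :=
  ∃ n : ℕ, CategoryTheory.HasProjectiveDimensionLE (ModuleCat.of (QuadricRing q) M.carrier) n

/-- `M` has finite length over `R`. -/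
def HasFiniteLength : Prop := IsFiniteLength (QuadricRing q) M.carrier

/-- The depth of `M`: the supremum of the lengths of the `M`-regular sequences in the homogeneous
maximal ideal. -/
noncomputable def depth : ℕ∞ :=
  ⨆ (rs : List (QuadricRing q)) (_ : ∀ r ∈ rs, r ∈ irrelevantIdeal q)
    (_ : RingTheory.Sequence.IsRegular M.carrier rs), (rs.length : ℕ∞)

/-- `M` is a (nonzero) Cohen-Macaulay module: its depth equals its Krull dimension. -/
def IsCohenMacaulay : Prop :=
  (M.depth : WithBot ℕ∞) = Module.supportDim (QuadricRing q) M.carrier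

end GradedMod

/-- The cone of Betti diagrams `B_ℚ(R)`: the positive hull in `𝕍` of the Betti diagrams of all
finitely generated graded `R`-modules. -/
noncomputable def bettiCone (q : MvPolynomial (Fin 2) k) : PointedCone ℚ DiagramSpace :=
  PointedCone.hull ℚ {v | ∃ (M : GradedMod q) (F : MinimalResolution M), v = F.betti}

end Ring

/-- The ray `ℚ≥0 · v` spanned by `v`. -/
noncomputable def ray (v : DiagramSpace) : PointedCone ℚ DiagramSpace := PointedCone.hull ℚ {v}

/-- `ρ` is an extremal ray of the cone `C`: the ray spanned by a nonzero vector, which is a face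
of `C`, i.e. `ρ ⊆ C`, and a sum of two elements of `C` lies in `ρ` only if both summands do. -/
def IsExtremalRay (C ρ : PointedCone ℚ DiagramSpace) : Prop :=
  (∃ v, v ≠ 0 ∧ ρ = ray v) ∧ ρ.IsFaceOf C

/-- A Cohen-Macaulay module of finite projective dimension whose minimal resolution `F` is pure
of type `(d₀, d₁, ∞, …)`, where `d₀ < d₁ ≤ ∞`. -/
structure IsFirstKind {k : Type u} [Field k] {q : MvPolynomial (Fin 2) k} {M : GradedMod q}
    (F : MinimalResolution M) (d₀ : ℤ) (d₁ : WithTop ℤ) : Prop where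
  lt : (d₀ : WithTop ℤ) < d₁
  cohenMacaulay : M.IsCohenMacaulay
  finiteProjDim : M.HasFiniteProjDim
  pure : F.IsPure (finiteType d₀ d₁)

/-- A module of finite length and infinite projective dimension whose minimal resolution `F` is
pure of type `(d₀, d₁, d₁ + 1, d₁ + 2, …)`, where `d₀ < d₁`. -/
structure IsSecondKind {k : Type u} [Field k] {q : MvPolynomial (Fin 2) k} {M : GradedMod q}
    (F : MinimalResolution M) (d₀ d₁ : ℤ) : Prop where
  lt : d₀ < d₁
  finiteLength : M.HasFiniteLength
  infiniteProjDim : ¬ M.HasFiniteProjDim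
  pure : F.IsPure (infiniteType d₀ d₁)

/-! The cone is computed by squeezing it between an explicit set of inequalities, `diagramCone`, and
the hull of explicit pure diagrams, `pureDiagrams`. Choose a linear form `l` prime to `q` and a
complementary linear form `s`. Then `l` is a nonzerodivisor on `R`, `R` is free over `k[l]` on `1,
s`, and `R/l` is `k[ε]` with `s` mapping to `ε`.

Inequalities: since `l` is regular on `R`, a minimal resolution stays exact modulo `l` from
homological degree two on. By minimality its differentials there are `ε` times scalar matrices,
which only join generators whose degrees differ by one. Exactness over `k[ε]` makes these matrices
injective on `F₂, F₃, …` and surjective onto `F₂, F₃, …`, so `β_{2,j+1} ≤ β_{1,j}` and `β_{i+1,j+1}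
= β_{i,j}` for `i ≥ 2`. A `k[l]`-rank count on the first syzygies generated in degrees at most `n`
gives the remaining inequality, `two_mul_card_le`.

Decomposition: a diagram satisfying the inequalities splits, above column 0, into one-column tails
and constant infinite tails. The rank inequality says precisely that the entries of column 0 can be
matched with tails starting in larger degrees (`linearCombination_add_mem_of_dominated`), so the
diagram is a positive combination of pure ones.

Realization: the pure diagrams come, up to twist, from `R`, `R/l^e` and `R/l^e(l, s)`; the last is
resolved by a 2×2 matrix factorization.

Each pure diagram spans an extremal ray because the inequalities that it satisfies with equality are
inherited by its summands, and any extremal ray is spanned by a generator. Modules of kind (1) lie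
on these rays because, when `d₁` is finite, the depth is zero, hence the dimension is zero, hence
`F₀` and `F₁` have equal rank. For kind (2), `β₁ = 2β₀` forces all later Betti numbers to equal
`β₁`. -/

open MvPolynomial

/-! ### Coordinates adapted to a linear form prime to `q` -/

section Coordinates

variable {k : Type u} [Field k]

/-- A linear parameter `param` on `R = k[x,y]/⟨q⟩` together with a complementary linear form `gen`,
and the reduction `R → k[ε]` modulo `param`. -/
structure LinearParameter (q : MvPolynomial (Fin 2) k) where
  /-- the parameter -/
  param : QuadricRing q
  /-- the complementary linear form -/
  gen : QuadricRing q
  /-- the linear form with `gen * gen = param * cofactor` -/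
  cofactor : QuadricRing q
  /-- the reduction modulo `param` -/
  red : QuadricRing q →ₐ[k] DualNumber k
  param_mem : param ∈ gradedPiece q 1
  gen_mem : gen ∈ gradedPiece q 1
  cofactor_mem : cofactor ∈ gradedPiece q 1
  gen_mul_gen : gen * gen = param * cofactor
  red_param : red param = 0
  red_gen : red gen = DualNumber.eps
  dvd_of_red_eq_zero : ∀ r, red r = 0 → param ∣ r
  eq_zero_of_param_mul : ∀ r, param * r = 0 → r = 0
  exists_X_eq : ∀ i, ∃ a b : k, Ideal.Quotient.mk (Ideal.span {q}) (X i) =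
    algebraMap k _ a * gen + algebraMap k _ b * param

theorem MvPolynomial.IsHomogeneous.exists_quadratic {q : MvPolynomial (Fin 2) k}
    (hq : q.IsHomogeneous 2) :
    ∃ a b c : k, q = C a * (X 0 * X 0) + C b * (X 0 * X 1) + C c * (X 1 * X 1) := by
  have h : q ∈ (homogeneousSubmodule (Fin 2) k 1) ^ 2 := by
    rw [homogeneousSubmodule_one_pow]; exact hq
  rw [homogeneousSubmodule_one_eq_span_X, pow_two, Submodule.span_mul_span] at h
  clear hq
  induction h using Submodule.span_induction with
  | mem x hx =>
    obtain ⟨_, ⟨i, rfl⟩, _, ⟨j, rfl⟩, rfl⟩ := hx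
    fin_cases i <;> fin_cases j
    · exact ⟨1, 0, 0, by simp⟩
    · exact ⟨0, 1, 0, by simp⟩
    · exact ⟨0, 1, 0, by simp [mul_comm]⟩
    · exact ⟨0, 0, 1, by simp⟩
  | zero => exact ⟨0, 0, 0, by simp⟩
  | add x y _ _ hx hy =>
    obtain ⟨a, b, c, rfl⟩ := hx
    obtain ⟨a', b', c', rfl⟩ := hy
    exact ⟨a + a', b + b', c + c', by simp only [C_add]; ring⟩
  | smul r x _ hx =>
    obtain ⟨a, b, c, rfl⟩ := hx
    exact ⟨r * a, r * b, r * c, by simp only [MvPolynomial.C_mul, MvPolynomial.smul_eq_C_mul]; ring⟩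

theorem mk_mem_gradedPiece (q : MvPolynomial (Fin 2) k) {f : MvPolynomial (Fin 2) k} {n : ℕ}
    (hf : f.IsHomogeneous n) : Ideal.Quotient.mk (Ideal.span {q}) f ∈ gradedPiece q n := by
  rw [gradedPiece, if_pos (Int.natCast_nonneg n), Int.toNat_natCast]
  exact ⟨f, hf, rfl⟩

theorem exists_linearParameter_aux {x y s l : MvPolynomial (Fin 2) k} (lam mu lam' mu' : k)
    (hx : x = C lam * s + C lam' * l) (hy : y = C mu * s + C mu' * l) (a b c : k) :
    C a * (x * x) + C b * (x * y) + C c * (y * y) =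
      C (a * (lam * lam) + b * (lam * mu) + c * (mu * mu)) * (s * s) +
      l * (C (a * (2 * lam * lam') + b * (lam * mu' + lam' * mu) + c * (2 * mu * mu')) * s +
        C (a * (lam' * lam') + b * (lam' * mu') + c * (mu' * mu')) * l) := by
  subst hx hy
  simp only [C_mul, C_add, map_ofNat]
  ring

theorem exists_sub_mul_of_X_mem {s l : MvPolynomial (Fin 2) k} (lam mu lam' mu' : k)
    (hx : X 0 = C lam * s + C lam' * l) (hy : X 1 = C mu * s + C mu' * l)
    (f : MvPolynomial (Fin 2) k) :
    ∃ (p : Polynomial k) (g : MvPolynomial (Fin 2) k), f = Polynomial.aeval s p + l * g := by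
  induction f using MvPolynomial.induction_on with
  | C a => exact ⟨Polynomial.C a, 0, by simp [MvPolynomial.algebraMap_eq]⟩
  | add f g hf hg =>
    obtain ⟨p, u, rfl⟩ := hf
    obtain ⟨p', u', rfl⟩ := hg
    exact ⟨p + p', u + u', by simp only [map_add]; ring⟩
  | mul_X f i hf =>
    obtain ⟨p, u, rfl⟩ := hf
    have key : ∀ a b : k, ∃ (p' : Polynomial k) (g : MvPolynomial (Fin 2) k),
        (Polynomial.aeval s p + l * u) * (C a * s + C b * l) = Polynomial.aeval s p' + l * g := by
      intro a b
      refine ⟨Polynomial.C a * (p * Polynomial.X),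
        u * (C a * s + C b * l) + Polynomial.aeval s p * C b, ?_⟩
      simp only [map_mul, Polynomial.aeval_C, Polynomial.aeval_X, MvPolynomial.algebraMap_eq]
      ring
    fin_cases i
    · simpa only [Fin.zero_eta, hx] using key lam lam'
    · simpa only [Fin.mk_one, hy] using key mu mu'

/-- Every nonzero binary quadratic form is prime to some linear form. -/
theorem exists_linearParameter {q : MvPolynomial (Fin 2) k} (hq : q.IsHomogeneous 2)
    (hq0 : q ≠ 0) : Nonempty (LinearParameter q) := by
  obtain ⟨a, b, c, hqe⟩ := hq.exists_quadratic
  -- Three points suffice to detect a nonzero binary quadratic form, so no assumption on the size of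
  -- `k` is needed.
  obtain ⟨lam, mu, hne⟩ : ∃ lam mu : k, a * (lam * lam) + b * (lam * mu) + c * (mu * mu) ≠ 0 := by
    by_contra! h
    have h1 : a = 0 := by simpa using h 1 0
    have h2 : c = 0 := by simpa using h 0 1
    have h3 : b = 0 := by simpa [h1, h2] using h 1 1
    exact hq0 (by rw [hqe, h1, h2, h3]; simp)
  -- `l` vanishes at the point `(lam, mu)` and `s` takes the value 1 there; the evaluation is
  -- restriction to the line through that point. The cases differ in which coordinate of the point
  -- is inverted.
  obtain ⟨s, l, lam', mu', hs, hl, hx, hy, hσs, hσl⟩ :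
      ∃ (s l : MvPolynomial (Fin 2) k) (lam' mu' : k), s.IsHomogeneous 1 ∧ l.IsHomogeneous 1 ∧
        X 0 = C lam * s + C lam' * l ∧ X 1 = C mu * s + C mu' * l ∧
        aeval (R := k) ![Polynomial.C lam * Polynomial.X, Polynomial.C mu * Polynomial.X] s =
          Polynomial.X ∧
        aeval (R := k) ![Polynomial.C lam * Polynomial.X, Polynomial.C mu * Polynomial.X] l =
          0 := by
    by_cases h0 : lam = 0
    · have hmu : mu ≠ 0 := by rintro rfl; simp [h0] at hne
      refine ⟨C mu⁻¹ * X 1, X 0, 1, 0, isHomogeneous_C_mul_X _ _, isHomogeneous_X _ _, ?_, ?_, ?_,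
        ?_⟩
      · simp [h0]
      · rw [← mul_assoc, ← C_mul, mul_inv_cancel₀ hmu]; simp
      · simp only [map_mul, aeval_X, algHom_C, Polynomial.algebraMap_eq]
        simp [← mul_assoc, ← Polynomial.C_mul, hmu]
      · simp [h0]
    · refine ⟨C lam⁻¹ * X 0, X 1 - C (mu * lam⁻¹) * X 0, 0, 1, isHomogeneous_C_mul_X _ _,
        (isHomogeneous_X _ _).sub (isHomogeneous_C_mul_X _ _), ?_, ?_, ?_, ?_⟩
      · rw [← mul_assoc, ← C_mul, mul_inv_cancel₀ h0]; simp
      · simp only [C_mul, C_1]; ring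
      · simp only [map_mul, aeval_X, algHom_C, Polynomial.algebraMap_eq]
        simp [← mul_assoc, ← Polynomial.C_mul, h0]
      · simp only [map_mul, map_sub, aeval_X, algHom_C, Polynomial.algebraMap_eq]
        simp only [Matrix.cons_val_one, Matrix.cons_val_zero, Matrix.cons_val_fin_one]
        rw [← mul_assoc, mul_assoc (Polynomial.C mu), ← Polynomial.C_mul, inv_mul_cancel₀ h0,
          Polynomial.C_1, mul_one, sub_self]
  set σ := aeval (R := k) ![Polynomial.C lam * Polynomial.X, Polynomial.C mu * Polynomial.X]
    with hσ
  rw [exists_linearParameter_aux lam mu lam' mu' hx hy a b c] at hqe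
  set γ := a * (lam * lam) + b * (lam * mu) + c * (mu * mu)
  set β := a * (2 * lam * lam') + b * (lam * mu' + lam' * mu) + c * (2 * mu * mu')
  set α := a * (lam' * lam') + b * (lam' * mu') + c * (mu' * mu')
  have hl0 : l ≠ 0 := by
    rintro rfl
    have h1 : (X 0 * C mu : MvPolynomial (Fin 2) k) = X 1 * C lam := by
      rw [hx, hy]; simp only [mul_zero, add_zero]; ring
    have h2 := congrArg (eval ![1, 0]) h1
    have h3 := congrArg (eval ![0, 1]) h1
    simp only [map_mul, eval_X, eval_C, Matrix.cons_val_zero, Matrix.cons_val_one,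
      Matrix.cons_val_fin_one, one_mul, zero_mul] at h2 h3
    exact hne (by simp only [γ, h2, ← h3]; ring)
  have hσaeval : ∀ p : Polynomial k, σ (Polynomial.aeval s p) = p := fun p => by
    rw [← Polynomial.aeval_algHom_apply, hσs, Polynomial.aeval_X_left_apply]
  have hker : ∀ f, σ f = 0 → l ∣ f := by
    intro f hf
    obtain ⟨p, g, rfl⟩ := exists_sub_mul_of_X_mem lam mu lam' mu' hx hy f
    rw [map_add, map_mul, hσl, zero_mul, add_zero, hσaeval] at hf
    simp [hf]
  have hσq : σ q = Polynomial.C γ * (Polynomial.X * Polynomial.X) := by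
    rw [hqe]
    simp only [map_add, map_mul, hσs, hσl, algHom_C, Polynomial.algebraMap_eq]
    ring
  let τ : MvPolynomial (Fin 2) k →ₐ[k] DualNumber k :=
    (Polynomial.aeval (DualNumber.eps : DualNumber k)).comp σ
  have hτ : ∀ f ∈ Ideal.span {q}, τ f = 0 := by
    intro f hf
    obtain ⟨g, rfl⟩ := Ideal.mem_span_singleton'.1 hf
    simp [τ, hσq]
  let π : MvPolynomial (Fin 2) k →ₐ[k] QuadricRing q := Ideal.Quotient.mkₐ k (Ideal.span {q})
  have hπ : ∀ f, π f = Ideal.Quotient.mk (Ideal.span {q}) f := fun f => rfl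
  have hπC : ∀ r : k, π (C r) = algebraMap k _ r := fun r => π.commutes r
  have hπq : π q = 0 := Ideal.Quotient.eq_zero_iff_mem.2 (Ideal.mem_span_singleton_self q)
  have hcof : (-(C γ⁻¹ * (C β * s + C α * l))).IsHomogeneous 1 :=
    (((hs.C_mul β).add (hl.C_mul α)).C_mul _).neg
  have hss : π s * π s = π l * π (-(C γ⁻¹ * (C β * s + C α * l))) := by
    rw [← map_mul, ← map_mul, ← sub_eq_zero, ← map_sub]
    have hγ : (C γ⁻¹ * C γ : MvPolynomial (Fin 2) k) = 1 := by
      rw [← C_mul, inv_mul_cancel₀ hne, C_1]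
    -- In the new coordinates `q = γ s² + l (β s + α l)` with `γ` invertible, so `q = 0` in `R`
    -- expresses `s²` as a multiple of `l`.
    have : s * s - l * -(C γ⁻¹ * (C β * s + C α * l)) = C γ⁻¹ * q := by
      linear_combination (-(s * s)) * hγ - C γ⁻¹ * hqe
    rw [this, map_mul, hπq, mul_zero]
  refine ⟨⟨π l, π s, π (-(C γ⁻¹ * (C β * s + C α * l))), Ideal.Quotient.liftₐ _ τ hτ,
    mk_mem_gradedPiece q hl, mk_mem_gradedPiece q hs, mk_mem_gradedPiece q hcof,
    hss, ?_, ?_, ?_, ?_, ?_⟩⟩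
  · change τ l = 0
    simp [τ, hσl]
  · change τ s = _
    simp [τ, hσs]
  · intro r hr
    obtain ⟨f, rfl⟩ := Ideal.Quotient.mk_surjective r
    change τ f = 0 at hr
    obtain ⟨p, g, rfl⟩ := exists_sub_mul_of_X_mem lam mu lam' mu' hx hy f
    have hp : Polynomial.aeval (DualNumber.eps : DualNumber k) p = 0 := by
      have := hr
      simp only [τ, AlgHom.comp_apply, map_add, map_mul, hσl, hσaeval, map_zero, zero_mul,
        add_zero] at this
      exact this
    have hp2 : Polynomial.X ^ 2 ∣ p := by
      rw [Polynomial.X_pow_dvd_iff]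
      intro d hd
      have hmod : p = Polynomial.C (p.coeff 0) + Polynomial.C (p.coeff 1) * Polynomial.X +
          Polynomial.X ^ 2 * p.divX.divX := by
        conv_lhs => rw [← p.divX_mul_X_add, ← p.divX.divX_mul_X_add]
        simp only [Polynomial.coeff_divX]
        ring
      rw [hmod] at hp
      simp only [map_add, map_mul, Polynomial.aeval_C, Polynomial.aeval_X, map_pow,
        DualNumber.eps_pow_two, zero_mul, add_zero] at hp
      have h1 := congrArg TrivSqZeroExt.fst hp
      have h2 := congrArg TrivSqZeroExt.snd hp
      simp [TrivSqZeroExt.algebraMap_eq_inl] at h1 h2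
      interval_cases d
      · exact h1
      · exact h2
    obtain ⟨p', rfl⟩ := hp2
    rw [← hπ, map_add, map_mul π l g]
    refine dvd_add ?_ (Dvd.intro _ rfl)
    rw [map_mul, map_pow, Polynomial.aeval_X, map_mul, map_pow, pow_two, hss, mul_assoc]
    exact Dvd.intro _ rfl
  · intro r hr
    obtain ⟨f, rfl⟩ := Ideal.Quotient.mk_surjective r
    rw [← hπ, ← map_mul, hπ, Ideal.Quotient.eq_zero_iff_mem] at hr
    obtain ⟨g, hg⟩ := Ideal.mem_span_singleton'.1 hr
    -- From `l f = g q`, restriction to the line gives `σ g = 0`, because `σ q = γ t²` is nonzero.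
    -- Hence `l` divides `g`, and it cancels.
    have h1 : σ g * σ q = 0 := by rw [← map_mul, hg, map_mul, hσl, zero_mul]
    have h2 : σ q ≠ 0 := by
      rw [hσq]
      simp [hne]
    obtain ⟨g', rfl⟩ := hker g ((mul_eq_zero.1 h1).resolve_right h2)
    have : f = g' * q := mul_left_cancel₀ hl0 (by rw [← hg]; ring)
    rw [this, map_mul, ← hπ q, hπq, mul_zero]
  · intro i
    have key : ∀ u v : k, π (C u * s + C v * l) =
        algebraMap k _ u * π s + algebraMap k _ v * π l := by
      intro u v
      rw [map_add, map_mul, map_mul, hπC, hπC]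
    fin_cases i
    · exact ⟨lam, lam', by rw [← key, ← hx]; rfl⟩
    · exact ⟨mu, mu', by rw [← key, ← hy]; rfl⟩

end Coordinates

/-! ### Reduction modulo the parameter, and `R` as a module over `k[l]` -/

section Reduction

variable {k : Type u} [Field k] {q : MvPolynomial (Fin 2) k}

theorem param_smul_eq_zero_pi (Λ : LinearParameter q) {ι : Type*} (v : ι → QuadricRing q)
    (h : Λ.param • v = 0) : v = 0 :=
  funext fun i => Λ.eq_zero_of_param_mul _ (congrFun h i)

namespace LinearParameter

variable (Λ : LinearParameter q)

theorem exists_red_X (i : Fin 2) : ∃ a : k,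
    Λ.red (Ideal.Quotient.mk (Ideal.span {q}) (X i)) = a • (DualNumber.eps : DualNumber k) := by
  obtain ⟨a, b, h⟩ := Λ.exists_X_eq i
  refine ⟨a, ?_⟩
  rw [h, map_add, map_mul, map_mul, Λ.red_param, Λ.red_gen, mul_zero, add_zero, AlgHom.commutes,
    Algebra.smul_def]

theorem fst_red_of_mem_irrelevantIdeal {r : QuadricRing q} (hr : r ∈ irrelevantIdeal q) :
    (Λ.red r).fst = 0 := by
  let f : QuadricRing q →+* k := (TrivSqZeroExt.fstHom k k k).toRingHom.comp Λ.red.toRingHom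
  have : irrelevantIdeal q ≤ RingHom.ker f := by
    rw [irrelevantIdeal, Ideal.span_le]
    rintro _ ⟨i, rfl⟩
    obtain ⟨a, ha⟩ := Λ.exists_red_X i
    change (Λ.red _).fst = 0
    rw [ha]
    simp
  exact this hr

/-- The reduction respects degrees, with `ε` in degree one: forms of degree `n` are sums of products
of `n` linear forms, so they land in the span of `ε ^ n`. -/
theorem snd_red_of_mem_gradedPiece {n : ℤ} (hn : n ≠ 1) {r : QuadricRing q}
    (hr : r ∈ gradedPiece q n) : (Λ.red r).snd = 0 := by
  rw [gradedPiece] at hr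
  split_ifs at hr with h0
  · lift n to ℕ using h0
    rw [Int.toNat_natCast] at hr
    obtain ⟨f, hf, rfl⟩ := hr
    let φ : MvPolynomial (Fin 2) k →ₐ[k] DualNumber k :=
      Λ.red.comp (Ideal.Quotient.mkₐ k (Ideal.span {q}))
    change (φ f).snd = 0
    have hφ : (homogeneousSubmodule (Fin 2) k 1).map φ.toLinearMap ≤
        Submodule.span k {(DualNumber.eps : DualNumber k)} := by
      rw [homogeneousSubmodule_one_eq_span_X, Submodule.map_span, Submodule.span_le]
      rintro _ ⟨_, ⟨i, rfl⟩, rfl⟩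
      obtain ⟨a, ha⟩ := Λ.exists_red_X i
      exact Submodule.mem_span_singleton.2 ⟨a, ha.symm⟩
    have hmem : φ f ∈ (Submodule.span k {(DualNumber.eps : DualNumber k)}) ^ n := by
      have h1 : φ f ∈ (homogeneousSubmodule (Fin 2) k n).map φ.toLinearMap := ⟨f, hf, rfl⟩
      rw [← homogeneousSubmodule_one_pow, Submodule.map_pow] at h1
      exact pow_le_pow_left' hφ n h1
    rw [Submodule.span_pow, Set.singleton_pow] at hmem
    obtain ⟨a, ha⟩ := Submodule.mem_span_singleton.1 hmem
    rw [← ha]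
    rcases n with _ | _ | n
    · simp
    · simp at hn
    · rw [pow_succ, pow_succ, mul_assoc, DualNumber.eps_mul_eps]
      simp
  · rw [(Submodule.mem_bot _).1 hr]
    simp

theorem eq_zero_of_mem_irrelevantIdeal (Λ : LinearParameter q) {n : ℤ} (hn : n ≤ 0) {r : QuadricRing q}
    (hr : r ∈ gradedPiece q n) (hr' : r ∈ irrelevantIdeal q) : r = 0 := by
  rw [gradedPiece] at hr
  split_ifs at hr with h0
  · obtain rfl : n = 0 := le_antisymm hn h0
    obtain ⟨f, hf, rfl⟩ := hr
    rw [Int.toNat_zero, homogeneousSubmodule_zero] at hf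
    obtain ⟨a, rfl⟩ := Submodule.mem_one.1 hf
    have h := Λ.fst_red_of_mem_irrelevantIdeal hr'
    change (Λ.red (Ideal.Quotient.mkₐ k _ (algebraMap _ _ a))).fst = 0 at h
    rw [AlgHom.commutes, AlgHom.commutes] at h
    have : a = 0 := by simpa [TrivSqZeroExt.algebraMap_eq_inl] using h
    simp [this]
  · exact (Submodule.mem_bot _).1 hr

theorem exists_eq_param_smul {ι : Type*} (v : ι → QuadricRing q) (h : ∀ i, Λ.red (v i) = 0) :
    ∃ w : ι → QuadricRing q, v = Λ.param • w := by
  choose w hw using fun i => Λ.dvd_of_red_eq_zero _ (h i)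
  exact ⟨w, funext hw⟩

/-- `R` is generated by `1` and `gen` over the subring generated by the parameter. -/
theorem exists_eq_aeval_add (r : QuadricRing q) : ∃ p p' : Polynomial k,
    r = Polynomial.aeval Λ.param p + Polynomial.aeval Λ.param p' * Λ.gen := by
  have hlin : ∀ (r x : QuadricRing q) (a b : k),
      x = algebraMap k _ a * Λ.gen + algebraMap k _ b * Λ.param →
      ∀ {u v : k}, Λ.cofactor = algebraMap k _ u * Λ.gen + algebraMap k _ v * Λ.param →
      (∃ p p' : Polynomial k,
        r = Polynomial.aeval Λ.param p + Polynomial.aeval Λ.param p' * Λ.gen) →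
      ∃ p p' : Polynomial k,
        r * x = Polynomial.aeval Λ.param p + Polynomial.aeval Λ.param p' * Λ.gen := by
    rintro _ x a b rfl u v huv ⟨p, p', rfl⟩
    have hs := Λ.gen_mul_gen
    rw [huv] at hs
    refine ⟨p * Polynomial.C b * Polynomial.X +
      p' * Polynomial.C a * Polynomial.C v * Polynomial.X ^ 2,
      p * Polynomial.C a + p' * Polynomial.C a * Polynomial.C u * Polynomial.X +
        p' * Polynomial.C b * Polynomial.X, ?_⟩
    simp only [map_add, map_mul, map_pow, Polynomial.aeval_C, Polynomial.aeval_X]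
    linear_combination (Polynomial.aeval Λ.param p' * algebraMap k _ a) * hs
  have hcof : ∃ u v : k, Λ.cofactor = algebraMap k _ u * Λ.gen + algebraMap k _ v * Λ.param := by
    have h := Λ.cofactor_mem
    rw [gradedPiece, if_pos zero_le_one] at h
    obtain ⟨f, hf, hfc⟩ := h
    rw [← hfc]
    rw [Int.toNat_one, homogeneousSubmodule_one_eq_span_X] at hf
    clear hfc
    induction hf using Submodule.span_induction with
    | mem x hx =>
      obtain ⟨i, rfl⟩ := hx
      exact Λ.exists_X_eq i
    | zero => exact ⟨0, 0, by simp⟩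
    | add x y _ _ hx hy =>
      obtain ⟨a, b, h⟩ := hx
      obtain ⟨a', b', h'⟩ := hy
      exact ⟨a + a', b + b', by simp only [map_add, h, h']; ring⟩
    | smul c x _ hx =>
      obtain ⟨a, b, h⟩ := hx
      refine ⟨c * a, c * b, ?_⟩
      have hc : Ideal.Quotient.mkₐ k (Ideal.span {q}) (C c) = algebraMap k _ c := AlgHom.commutes _ c
      rw [AlgHom.toLinearMap_apply] at h ⊢
      rw [MvPolynomial.smul_eq_C_mul, map_mul, h, hc]
      simp only [map_mul]; ring
  obtain ⟨u, v, huv⟩ := hcof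
  obtain ⟨f, rfl⟩ := Ideal.Quotient.mk_surjective r
  induction f using MvPolynomial.induction_on with
  | C a => exact ⟨Polynomial.C a, 0, by simp; rfl⟩
  | add f g hf hg =>
    obtain ⟨p, p', h⟩ := hf
    obtain ⟨r, r', h'⟩ := hg
    exact ⟨p + r, p' + r', by simp only [map_add, h, h']; ring⟩
  | mul_X f i hf =>
    obtain ⟨a, b, h⟩ := Λ.exists_X_eq i
    rw [map_mul]
    exact hlin _ _ a b h huv hf

/-- Independence modulo `l` lifts to independence over `k[l]`: every relation has coefficients
divisible by `l`, and dividing by `l` gives another relation, so the coefficients are divisible by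
all powers of `l`. -/
theorem eq_zero_of_sum_aeval_smul {V ι : Type*} [AddCommGroup V] [Module (QuadricRing q) V]
    [Fintype ι] (hV : ∀ x : V, Λ.param • x = 0 → x = 0) (v : ι → V)
    (h : ∀ p : ι → Polynomial k, ∑ i, Polynomial.aeval Λ.param (p i) • v i = 0 →
      ∀ i, (p i).coeff 0 = 0) (p : ι → Polynomial k)
    (hp : ∑ i, Polynomial.aeval Λ.param (p i) • v i = 0) : p = 0 := by
  have key : ∀ (n : ℕ) (p : ι → Polynomial k),
      ∑ i, Polynomial.aeval Λ.param (p i) • v i = 0 → ∀ i, Polynomial.X ^ n ∣ p i := by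
    intro n
    induction n with
    | zero => simp
    | succ n ih =>
      intro p hp i
      choose p' hp' using fun i => Polynomial.X_dvd_iff.2 (h p hp i)
      have : ∑ i, Polynomial.aeval Λ.param (p' i) • v i = 0 := by
        apply hV
        rw [← hp, Finset.smul_sum]
        refine Finset.sum_congr rfl fun i _ => ?_
        rw [hp', map_mul, Polynomial.aeval_X, mul_smul]
      rw [hp', pow_succ']
      exact mul_dvd_mul_left _ (ih p' this i)
  funext i
  by_contra hne
  have h1 := Polynomial.natDegree_le_of_dvd (key ((p i).natDegree + 1) p hp i) hne
  simp at h1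

/-- The family is independent over `k[l]`, and `R^m` is generated over `k[l]` by `2|m|` elements.
Writing coordinates with respect to `1` and `gen` moves the count to a free `k[X]`-module. -/
theorem card_le_of_forall_coeff_eq_zero {ι m : Type*} [Fintype ι] [Fintype m]
    (v : ι → m → QuadricRing q)
    (h : ∀ p : ι → Polynomial k, ∑ i, Polynomial.aeval Λ.param (p i) • v i = 0 →
      ∀ i, (p i).coeff 0 = 0) : Fintype.card ι ≤ 2 * Fintype.card m := by
  choose w w' hw using fun (i : ι) (b : m) => Λ.exists_eq_aeval_add (v i b)
  let W : ι → (m × Bool → Polynomial k) := fun i bc => if bc.2 then w i bc.1 else w' i bc.1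
  have hW : LinearIndependent (Polynomial k) W := by
    rw [Fintype.linearIndependent_iff]
    intro p hp i
    refine congrFun (Λ.eq_zero_of_sum_aeval_smul (param_smul_eq_zero_pi Λ) v h p ?_) i
    funext b
    have h1 := congrFun hp (b, true)
    have h2 := congrFun hp (b, false)
    simp only [Finset.sum_apply, Pi.smul_apply, smul_eq_mul, W, if_true, Pi.zero_apply,
      Bool.false_eq_true, if_false] at h1 h2
    simp only [Finset.sum_apply, Pi.smul_apply, smul_eq_mul, Pi.zero_apply, hw, mul_add,
      Finset.sum_add_distrib, ← mul_assoc, ← map_mul, ← Finset.sum_mul, ← map_sum, h1, h2]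
    simp
  have := hW.fintype_card_le_finrank
  rw [Module.finrank_pi, Fintype.card_prod, Fintype.card_bool] at this
  omega

/-- Separatedness for the `l`-adic topology, read off from the uniqueness of coordinates in the
basis `1, gen`. It replaces Nakayama's lemma below, where the maps need not be graded. -/
theorem eq_zero_of_forall_pow_dvd (r : QuadricRing q) (h : ∀ n, Λ.param ^ n ∣ r) : r = 0 := by
  have huniq : ∀ p : Bool → Polynomial k,
      ∑ i, Polynomial.aeval Λ.param (p i) • (bif i then 1 else Λ.gen : QuadricRing q) = 0 →
      p = 0 := by
    refine Λ.eq_zero_of_sum_aeval_smul Λ.eq_zero_of_param_mul _ fun p hp => ?_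
    have h1 := congrArg Λ.red hp
    have hred : ∀ f : Polynomial k, Λ.red (Polynomial.aeval Λ.param f) =
        algebraMap k _ (f.coeff 0) := by
      intro f
      rw [← Polynomial.aeval_algHom_apply, Λ.red_param, Polynomial.aeval_def,
        Polynomial.eval₂_at_zero]
    simp only [Fintype.sum_bool, cond_true, cond_false, smul_eq_mul, map_add, map_mul, hred,
      map_one, map_zero, Λ.red_gen] at h1
    have h2 := congrArg TrivSqZeroExt.fst h1
    have h3 := congrArg TrivSqZeroExt.snd h1
    simp [TrivSqZeroExt.algebraMap_eq_inl] at h2 h3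
    rintro (_ | _)
    · exact h3
    · exact h2
  obtain ⟨p, p', hr⟩ := Λ.exists_eq_aeval_add r
  have hdvd : ∀ n, Polynomial.X ^ n ∣ p ∧ Polynomial.X ^ n ∣ p' := by
    intro n
    obtain ⟨r', hr'⟩ := h n
    obtain ⟨t, t', ht⟩ := Λ.exists_eq_aeval_add r'
    have := huniq (fun i => bif i then p - Polynomial.X ^ n * t else p' - Polynomial.X ^ n * t') (by
      simp only [Fintype.sum_bool, cond_true, cond_false, smul_eq_mul, map_sub, map_mul, map_pow,
        Polynomial.aeval_X]
      linear_combination hr' - hr + Λ.param ^ n * ht)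
    exact ⟨⟨t, sub_eq_zero.1 (congrFun this true)⟩, ⟨t', sub_eq_zero.1 (congrFun this false)⟩⟩
  have hz : ∀ f : Polynomial k, (∀ n, Polynomial.X ^ n ∣ f) → f = 0 := by
    intro f hf
    by_contra hne
    have h1 := Polynomial.natDegree_le_of_dvd (hf (f.natDegree + 1)) hne
    simp at h1
  rw [hr, hz p fun n => (hdvd n).1, hz p' fun n => (hdvd n).2]
  simp

end LinearParameter

end Reduction

/-! ### Counting rows and columns of block matrices -/

section BlockMatrices

variable {k A B : Type*} [Field k] [Fintype A]

theorem submatrix_mulVec_restrict (D : Matrix B A k) (p : A → Prop) [DecidablePred p]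
    (t : B → Prop) (z : A → k) (hz : ∀ a b, ¬ p a → t b → D b a * z a = 0) (b : {b // t b}) :
    Matrix.mulVec (D.submatrix (Subtype.val : {b // t b} → B) (Subtype.val : {a // p a} → A))
      (fun a => z a) b = D.mulVec z b := by
  simp only [Matrix.mulVec, dotProduct, Matrix.submatrix_apply]
  rw [← Fintype.sum_subtype_add_sum_subtype p (fun a => D b a * z a), left_eq_add]
  exact Finset.sum_eq_zero fun a _ => hz a b a.2 b.2

theorem submatrix_mulVec_injective {D : Matrix B A k} (hD : ∀ z, D.mulVec z = 0 → z = 0)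
    (p : A → Prop) [DecidablePred p] (t : B → Prop) (h : ∀ b a, D b a ≠ 0 → p a → t b) :
    Function.Injective
      (D.submatrix (Subtype.val : {b // t b} → B) (Subtype.val : {a // p a} → A)).mulVecLin := by
  rw [← LinearMap.ker_eq_bot, LinearMap.ker_eq_bot']
  intro z' hz'
  let z : A → k := fun a => if h : p a then z' ⟨a, h⟩ else 0
  have hzz : z' = fun a : {a // p a} => z a := by funext a; simp [z, a.2]
  have hz0 : ∀ a, ¬ p a → z a = 0 := fun a ha => dif_neg ha
  have : z = 0 := by
    apply hD
    funext b
    by_cases hb : t b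
    · rw [← submatrix_mulVec_restrict D p t z (fun a b ha _ => by rw [hz0 a ha, mul_zero]) ⟨b, hb⟩,
        ← hzz]
      exact congrFun hz' ⟨b, hb⟩
    · refine Finset.sum_eq_zero fun a _ => ?_
      by_cases ha : p a
      · have : D b a = 0 := by_contra fun hne => hb (h b a hne ha)
        simp [this]
      · simp [hz0 a ha]
  rw [hzz, this]
  rfl

theorem card_subtype_le_of_injective [Fintype B] {D : Matrix B A k} (hD : ∀ z, D.mulVec z = 0 → z = 0)
    (p : A → Prop) [DecidablePred p] (t : B → Prop) [DecidablePred t]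
    (h : ∀ b a, D b a ≠ 0 → p a → t b) :
    Fintype.card {a // p a} ≤ Fintype.card {b // t b} := by
  simpa using LinearMap.finrank_le_finrank_of_injective (submatrix_mulVec_injective hD p t h)

theorem card_subtype_le_of_surjective [Fintype B] {D : Matrix B A k} (hD : ∀ w, ∃ z, D.mulVec z = w)
    (p : A → Prop) [DecidablePred p] (t : B → Prop) [DecidablePred t]
    (h : ∀ b a, D b a ≠ 0 → t b → p a) :
    Fintype.card {b // t b} ≤ Fintype.card {a // p a} := by
  have hs : Function.Surjective
      (D.submatrix (Subtype.val : {b // t b} → B) (Subtype.val : {a // p a} → A)).mulVecLin := by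
    intro w'
    obtain ⟨z, hz⟩ := hD fun b => if h : t b then w' ⟨b, h⟩ else 0
    refine ⟨fun a => z a, funext fun b => ?_⟩
    rw [Matrix.mulVecLin_apply, submatrix_mulVec_restrict D p t z, hz]
    · simp [b.2]
    · intro a b ha hb
      rw [by_contra fun hne => ha (h b a hne hb), zero_mul]
  simpa using LinearMap.finrank_le_finrank_of_surjective hs

end BlockMatrices

/-! ### Numerical inequalities for Betti diagrams -/

namespace MinimalResolution

variable {k : Type u} [Field k] {q : MvPolynomial (Fin 2) k} {M : GradedMod q}
  (F : MinimalResolution M) (Λ : LinearParameter q)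

theorem betti_apply (i : ℕ) (j : ℤ) :
    F.betti i j = Fintype.card {a : Fin (F.rank i) // F.deg i a = j} := by
  rw [betti, Finsupp.finsetSum_apply, Fintype.card_subtype, ← Finset.sum_boole]
  exact Finset.sum_congr rfl fun a _ => Finsupp.single_apply

/-- The matrix over `k` of the coefficients of `ε` in the differential modulo the parameter. -/
noncomputable def linearPart (i : ℕ) : Matrix (Fin (F.rank i)) (Fin (F.rank (i + 1))) k :=
  fun b a => (Λ.red (F.diff i (Pi.single a 1) b)).snd

theorem diff_apply (i : ℕ) (v : Fin (F.rank (i + 1)) → QuadricRing q) (b : Fin (F.rank i)) :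
    F.diff i v b = ∑ a, v a * F.diff i (Pi.single a 1) b := by
  conv_lhs => rw [pi_eq_sum_univ' v]
  simp only [map_sum, map_smul, Finset.sum_apply, Pi.smul_apply, smul_eq_mul]

theorem red_diff (i : ℕ) (v : Fin (F.rank (i + 1)) → QuadricRing q) (b : Fin (F.rank i)) :
    Λ.red (F.diff i v b) =
      TrivSqZeroExt.inr ((F.linearPart Λ i).mulVec (fun a => (Λ.red (v a)).fst) b) := by
  rw [diff_apply, map_sum, Matrix.mulVec, dotProduct, TrivSqZeroExt.inr_sum]
  refine Finset.sum_congr rfl fun a _ => ?_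
  have h := Λ.fst_red_of_mem_irrelevantIdeal (F.minimal i a b)
  rw [map_mul]
  refine TrivSqZeroExt.ext ?_ ?_
  · rw [TrivSqZeroExt.fst_mul, h, mul_zero, TrivSqZeroExt.fst_inr]
  · rw [DualNumber.snd_mul, h, mul_zero, add_zero, TrivSqZeroExt.snd_inr, mul_comm]
    rfl

theorem deg_eq_of_linearPart_ne_zero {i : ℕ} {a : Fin (F.rank (i + 1))} {b : Fin (F.rank i)}
    (h : F.linearPart Λ i b a ≠ 0) : F.deg (i + 1) a = F.deg i b + 1 := by
  by_contra hne
  exact h (Λ.snd_red_of_mem_gradedPiece (fun h' => hne (by omega)) (F.diff_homogeneous i a b))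

theorem diff_diff (i : ℕ) (v) : F.diff i (F.diff (i + 1) v) = 0 :=
  (F.exact_succ i _).2 ⟨v, rfl⟩

/-- The resolution stays exact modulo the parameter in homological degrees at least two. -/
theorem exists_red_eq_red_diff (i : ℕ) (v : Fin (F.rank (i + 2)) → QuadricRing q)
    (h : ∀ b, Λ.red (F.diff (i + 1) v b) = 0) :
    ∃ z, ∀ a, Λ.red (v a) = Λ.red (F.diff (i + 2) z a) := by
  obtain ⟨w, hw⟩ := Λ.exists_eq_param_smul _ h
  -- If `d v = l w`, then `l · d w = d (d v) = 0`, so `w` is a cycle and hence a boundary `d u`;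
  -- correcting `v` by `l u` gives a genuine cycle.
  have h1 : F.diff i w = 0 := by
    apply param_smul_eq_zero_pi Λ
    rw [← map_smul, ← hw, diff_diff]
  obtain ⟨u, rfl⟩ := (F.exact_succ i w).1 h1
  have h2 : F.diff (i + 1) (v - Λ.param • u) = 0 := by rw [map_sub, hw, map_smul, sub_self]
  obtain ⟨z, hz⟩ := (F.exact_succ (i + 1) _).1 h2
  refine ⟨z, fun a => ?_⟩
  rw [hz, Pi.sub_apply, Pi.smul_apply, smul_eq_mul, map_sub, map_mul, Λ.red_param, zero_mul,
    sub_zero]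

/-- A constant vector killed by the scalar matrix is a cycle modulo `l`, hence a boundary there; but
boundaries are multiples of `ε`. -/
theorem linearPart_injective (i : ℕ) (z : Fin (F.rank (i + 2)) → k)
    (hz : (F.linearPart Λ (i + 1)).mulVec z = 0) : z = 0 := by
  have hred : ∀ a, Λ.red (algebraMap k _ (z a)) = TrivSqZeroExt.inl (z a) := fun a => by
    rw [AlgHom.commutes]; rfl
  obtain ⟨y, hy⟩ := F.exists_red_eq_red_diff Λ i (fun a => algebraMap k _ (z a)) (fun b => by
    simp only [red_diff, hred, TrivSqZeroExt.fst_inl]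
    rw [hz, Pi.zero_apply, TrivSqZeroExt.inr_zero])
  funext a
  have := congrArg TrivSqZeroExt.fst (hy a)
  rwa [hred, red_diff, TrivSqZeroExt.fst_inl, TrivSqZeroExt.fst_inr] at this

/-- Since `ε² = 0`, every vector `ε w` is a cycle modulo `l`, hence `ε` times a value of the next
scalar matrix. -/
theorem linearPart_surjective (i : ℕ) (w : Fin (F.rank (i + 2)) → k) :
    ∃ z, (F.linearPart Λ (i + 2)).mulVec z = w := by
  have hred : ∀ a, Λ.red (Λ.gen * algebraMap k _ (w a)) = TrivSqZeroExt.inr (w a) := fun a => by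
    rw [map_mul, AlgHom.commutes, Λ.red_gen, mul_comm, ← Algebra.smul_def,
      ← DualNumber.inr_eq_smul_eps]
  obtain ⟨y, hy⟩ := F.exists_red_eq_red_diff Λ i (fun a => Λ.gen * algebraMap k _ (w a)) (fun b => by
    simp only [red_diff, hred, TrivSqZeroExt.fst_inr]
    rw [← Pi.zero_def, Matrix.mulVec_zero, Pi.zero_apply, TrivSqZeroExt.inr_zero])
  refine ⟨fun a => (Λ.red (y a)).fst, funext fun a => ?_⟩
  have := hy a
  rw [hred, red_diff] at this
  exact (TrivSqZeroExt.inr_injective this).symm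

theorem betti_nonneg (i : ℕ) (j : ℤ) : 0 ≤ F.betti i j := by
  rw [betti_apply]; positivity

theorem betti_succ_le (Λ : LinearParameter q) (i : ℕ) (j : ℤ) :
    F.betti (i + 2) (j + 1) ≤ F.betti (i + 1) j := by
  rw [betti_apply, betti_apply, Nat.cast_le]
  refine card_subtype_le_of_injective (F.linearPart_injective Λ i) _ _ fun b a hne ha => ?_
  have : F.deg (i + 2) a = F.deg (i + 1) b + 1 := F.deg_eq_of_linearPart_ne_zero Λ hne
  omega

theorem betti_succ_eq (Λ : LinearParameter q) (i : ℕ) (j : ℤ) :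
    F.betti (i + 3) (j + 1) = F.betti (i + 2) j := by
  refine le_antisymm (F.betti_succ_le Λ (i + 1) j) ?_
  rw [betti_apply, betti_apply, Nat.cast_le]
  refine card_subtype_le_of_surjective (F.linearPart_surjective Λ i) _ _ fun b a hne ha => ?_
  have : F.deg (i + 3) a = F.deg (i + 2) b + 1 := F.deg_eq_of_linearPart_ne_zero Λ hne
  omega

theorem diff_single_eq_zero (Λ : LinearParameter q) {i : ℕ} {a : Fin (F.rank (i + 1))}
    {b : Fin (F.rank i)} (h : F.deg (i + 1) a ≤ F.deg i b) : F.diff i (Pi.single a 1) b = 0 :=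
  Λ.eq_zero_of_mem_irrelevantIdeal (sub_nonpos.2 h) (F.diff_homogeneous i a b) (F.minimal i a b)

/-- The rank estimate for the submodule of the first syzygies generated in degrees at most `n`. -/
theorem two_mul_card_le (Λ : LinearParameter q) (n : ℤ) :
    2 * Fintype.card {a : Fin (F.rank 1) // F.deg 1 a ≤ n} ≤
      2 * Fintype.card {b : Fin (F.rank 0) // F.deg 0 b < n} +
        Fintype.card {c : Fin (F.rank 2) // F.deg 2 c ≤ n + 1} := by
  classical
  set D := F.linearPart Λ 1 with hDdef
  let p : Fin (F.rank 2) → Prop := fun c => F.deg 2 c ≤ n + 1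
  let t : Fin (F.rank 1) → Prop := fun a => F.deg 1 a ≤ n
  let D' := D.submatrix (Subtype.val : {b // t b} → _) (Subtype.val : {a // p a} → _)
  have hD' : Function.Injective D'.mulVecLin := by
    refine submatrix_mulVec_injective (F.linearPart_injective Λ 0) p t fun b a hne ha => ?_
    have : F.deg 2 a = F.deg 1 b + 1 := F.deg_eq_of_linearPart_ne_zero Λ hne
    simp only [p, t] at *
    omega
  let W := LinearMap.range D'.mulVecLin
  let β := Module.finBasis k (({b // t b} → k) ⧸ W)
  choose w hw using fun g => W.mkQ_surjective (β g)
  -- Basis vectors of `F₁` in degrees at most `n`, together with `s` times lifts of a basis of the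
  -- cokernel of `D'`. Their number is `2 #t - #p`, as `D'` is injective, and their images in `F₀`
  -- will be shown independent over `k[l]`.
  let vec : {a // t a} ⊕ Fin (Module.finrank k (({b // t b} → k) ⧸ W)) →
      Fin (F.rank 1) → QuadricRing q :=
    Sum.elim (fun a => Pi.single a.1 1)
      (fun g a => if h : t a then Λ.gen * algebraMap k _ (w g ⟨a, h⟩) else 0)
  have hvec : ∀ i a, ¬ t a → vec i a = 0 := by
    rintro (a' | g) a ha
    · exact Pi.single_eq_of_ne (fun h => ha (by rw [h]; exact a'.2)) _
    · exact dif_neg ha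
  have hcard := Λ.card_le_of_forall_coeff_eq_zero
    (fun i (b : {b : Fin (F.rank 0) // F.deg 0 b < n}) => F.diff 0 (vec i) b) (by
    intro c hc
    set V := ∑ i, Polynomial.aeval Λ.param (c i) • vec i with hV
    have hV0 : ∀ a, ¬ t a → V a = 0 := by
      intro a ha
      simp [hV, Finset.sum_apply, hvec _ a ha]
    have hdV : F.diff 0 V = 0 := by
      funext b
      by_cases hb : F.deg 0 b < n
      -- Only components of `F₀` in degrees less than `n` matter: by minimality, entries of the
      -- differential of degree at most zero vanish.
      · refine Eq.trans ?_ (congrFun hc ⟨b, hb⟩)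
        simp [hV, map_sum, Finset.sum_apply]
      · rw [diff_apply]
        refine Finset.sum_eq_zero fun a _ => ?_
        by_cases ha : t a
        · rw [F.diff_single_eq_zero Λ (ha.trans (not_lt.1 hb)), mul_zero]
        · rw [hV0 a ha, zero_mul]
    obtain ⟨z, hz⟩ := (F.exact_succ 0 V).1 hdV
    have hred : ∀ f : Polynomial k, Λ.red (Polynomial.aeval Λ.param f) =
        TrivSqZeroExt.inl (f.coeff 0) := by
      intro f
      rw [← Polynomial.aeval_algHom_apply, Λ.red_param, Polynomial.aeval_def,
        Polynomial.eval₂_at_zero]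
      rfl
    have hVa : ∀ a : {a // t a}, Λ.red (V a) = TrivSqZeroExt.inl ((c (Sum.inl a)).coeff 0) +
        TrivSqZeroExt.inr (∑ g, (c (Sum.inr g)).coeff 0 * w g a) := by
      intro a
      simp only [hV, Fintype.sum_sum_type, Pi.add_apply, Finset.sum_apply, Pi.smul_apply, vec,
        Sum.elim_inl, Sum.elim_inr, smul_eq_mul, map_add, map_sum, map_mul, hred]
      congr 1
      · rw [Finset.sum_eq_single a]
        · simp
        · intro a' _ hne
          rw [Pi.single_eq_of_ne (fun h => hne (Subtype.ext h.symm)), map_zero, mul_zero]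
        · simp
      · rw [TrivSqZeroExt.inr_sum]
        refine Finset.sum_congr rfl fun g _ => ?_
        rw [dif_pos a.2, map_mul, AlgHom.commutes, Λ.red_gen, mul_comm DualNumber.eps,
          ← Algebra.smul_def, ← DualNumber.inr_eq_smul_eps, TrivSqZeroExt.inl_mul_inr, smul_eq_mul]
    have hVz : ∀ a : {a // t a}, Λ.red (V a) =
        TrivSqZeroExt.inr (D.mulVec (fun c => (Λ.red (z c)).fst) a) := by
      intro a
      rw [← hz, red_diff]
    -- A relation `V` is a boundary, so modulo `l` it is `ε` times a value of `D`. Its constant part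
    -- therefore vanishes, and its `ε`-part, a combination of the `w g`, lies in the image of `D'`.
    have hmem : ∑ g, (c (Sum.inr g)).coeff 0 • w g ∈ W := by
      refine ⟨fun a => (Λ.red (z a)).fst, funext fun a => ?_⟩
      have h1 := congrArg TrivSqZeroExt.snd ((hVa a).symm.trans (hVz a))
      rw [TrivSqZeroExt.snd_add, TrivSqZeroExt.snd_inl, zero_add, TrivSqZeroExt.snd_inr,
        TrivSqZeroExt.snd_inr] at h1
      rw [Matrix.mulVecLin_apply]
      simp only [D']
      rw [submatrix_mulVec_restrict D p t (fun a => (Λ.red (z a)).fst), ← h1]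
      · simp [Finset.sum_apply]
      · intro a b ha hb
        by_cases h0 : D b a = 0
        · rw [h0, zero_mul]
        · have : F.deg 2 a = F.deg 1 b + 1 := F.deg_eq_of_linearPart_ne_zero Λ h0
          simp only [p, t] at *
          omega
    rintro (a | g)
    · have h1 := congrArg TrivSqZeroExt.fst ((hVa a).symm.trans (hVz a))
      simpa using h1
    · have h1 : ∑ g, (c (Sum.inr g)).coeff 0 • β g = 0 := by
        simp only [← hw, ← map_smul, ← map_sum]
        exact (Submodule.Quotient.mk_eq_zero W).2 hmem
      exact Fintype.linearIndependent_iff.1 β.linearIndependent _ h1 g)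
  have hfin : Module.finrank k (({b // t b} → k) ⧸ W) + Fintype.card {c // p c} =
      Fintype.card {a // t a} := by
    have h1 := W.finrank_quotient_add_finrank
    rw [LinearMap.finrank_range_of_inj hD', Module.finrank_pi, Module.finrank_pi] at h1
    exact h1
  rw [Fintype.card_sum, Fintype.card_fin] at hcard
  simp only [p, t] at *
  omega

end MinimalResolution

/-! ### Greedy matching of supply and demand -/

section Greedy

variable {W κ : Type*} [AddCommGroup W] [Module ℚ W]

theorem PointedCone.linearCombination_mem {ι : Type*} (C : PointedCone ℚ W) {P : ι → W}
    (hP : ∀ j, P j ∈ C) {f : ι →₀ ℚ} (hf : ∀ j, 0 ≤ f j) : Finsupp.linearCombination ℚ P f ∈ C :=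
  C.sum_mem fun j _ => C.smul_mem (hf j) (hP j)

/-- The sum of the values of `f` at the arguments less than `n`. -/
noncomputable def cumul (n : ℤ) : (ℤ →₀ ℚ) →ₗ[ℚ] ℚ :=
  Finsupp.linearCombination ℚ fun j => if j < n then 1 else 0

theorem cumul_single (n j : ℤ) (c : ℚ) : cumul n (Finsupp.single j c) = if j < n then c else 0 := by
  simp [cumul, Finsupp.linearCombination_single]

theorem linearCombination_indicator_nonneg {ι : Type*} (p : ι → Prop) [DecidablePred p]
    {f : ι →₀ ℚ} (hf : ∀ j, 0 ≤ f j) :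
    0 ≤ Finsupp.linearCombination ℚ (fun j => if p j then (1 : ℚ) else 0) f := by
  refine Finset.sum_nonneg fun j _ => mul_nonneg (hf j) ?_
  beta_reduce
  split_ifs <;> norm_num

/-- If the demand `g` up to any degree is dominated by the supply `f` in smaller degrees, then
demand and supply can be matched. -/
theorem linearCombination_add_mem_of_dominated (C : PointedCone ℚ W) {P : ℤ → W} {Q : κ → W}
    {h : κ → ℤ} (hP : ∀ j, P j ∈ C) (hPQ : ∀ j t, j < h t → P j + Q t ∈ C) (f : ℤ →₀ ℚ)
    (g : κ →₀ ℚ) (hf : ∀ j, 0 ≤ f j) (hg : ∀ t, 0 ≤ g t)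
    (hfg : ∀ n, Finsupp.linearCombination ℚ (fun t => if h t ≤ n then (1 : ℚ) else 0) g ≤
      cumul n f) :
    Finsupp.linearCombination ℚ P f + Finsupp.linearCombination ℚ Q g ∈ C := by
  classical
  induction hN : f.support.card + g.support.card using Nat.strong_induction_on generalizing f g with
  | _ N ih =>
  by_cases hg0 : g = 0
  · rw [hg0, map_zero, add_zero]
    exact C.linearCombination_mem hP hf
  -- Serve the lowest demand first, from any supply below it; subtracting the smaller of the two
  -- amounts empties one of the two entries.
  obtain ⟨t, ht, hmin⟩ := g.support.exists_min_image h (Finsupp.support_nonempty_iff.2 hg0)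
  have hgt : 0 < g t := lt_of_le_of_ne (hg t) (Ne.symm (Finsupp.mem_support_iff.1 ht))
  obtain ⟨j, hj, hjt⟩ : ∃ j ∈ f.support, j < h t := by
    by_contra! hcon
    have h1 : cumul (h t) f = 0 := by
      refine Finset.sum_eq_zero fun j hj => ?_
      simp [not_lt.2 (hcon j hj)]
    have h2 : g t ≤ Finsupp.linearCombination ℚ
        (fun t' => if h t' ≤ h t then (1 : ℚ) else 0) g := by
      refine le_trans ?_ (Finset.single_le_sum (f := fun t' =>
        g t' • if h t' ≤ h t then (1 : ℚ) else 0) (fun t' _ => mul_nonneg (hg t') ?_) ht)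
      · simp
      · split_ifs <;> norm_num
    linarith [hfg (h t)]
  have hfj : 0 < f j := lt_of_le_of_ne (hf j) (Ne.symm (Finsupp.mem_support_iff.1 hj))
  set c := min (f j) (g t) with hc
  have hc0 : 0 < c := lt_min hfj hgt
  set f' := f - Finsupp.single j c with hf'
  set g' := g - Finsupp.single t c with hg'
  have hfe : f = f' + Finsupp.single j c := (sub_add_cancel _ _).symm
  have hge : g = g' + Finsupp.single t c := (sub_add_cancel _ _).symm
  have hf'0 : ∀ i, 0 ≤ f' i := by
    intro i
    rw [hf', Finsupp.sub_apply, Finsupp.single_apply]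
    split_ifs with hi
    · subst hi; linarith [min_le_left (f j) (g t)]
    · linarith [hf i]
  have hg'0 : ∀ i, 0 ≤ g' i := by
    intro i
    rw [hg', Finsupp.sub_apply, Finsupp.single_apply]
    split_ifs with hi
    · subst hi; linarith [min_le_right (f j) (g t)]
    · linarith [hg i]
  have hfs : f'.support ⊆ f.support := by
    intro i hi
    rw [Finsupp.mem_support_iff] at hi ⊢
    intro h0
    apply hi
    rw [hf', Finsupp.sub_apply, Finsupp.single_apply, h0, if_neg, sub_zero]
    rintro rfl
    exact hfj.ne' h0
  have hgs : g'.support ⊆ g.support := by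
    intro i hi
    rw [Finsupp.mem_support_iff] at hi ⊢
    intro h0
    apply hi
    rw [hg', Finsupp.sub_apply, Finsupp.single_apply, h0, if_neg, sub_zero]
    rintro rfl
    exact hgt.ne' h0
  have hlt : f'.support.card + g'.support.card < N := by
    rw [← hN]
    rcases min_choice (f j) (g t) with h1 | h1
    · refine add_lt_add_of_lt_of_le (Finset.card_lt_card ⟨hfs, fun hsub => ?_⟩)
        (Finset.card_le_card hgs)
      have := Finsupp.mem_support_iff.1 (hsub hj)
      rw [hf', Finsupp.sub_apply, Finsupp.single_eq_same, hc, h1, sub_self] at this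
      exact this rfl
    · refine add_lt_add_of_le_of_lt (Finset.card_le_card hfs)
        (Finset.card_lt_card ⟨hgs, fun hsub => ?_⟩)
      have := Finsupp.mem_support_iff.1 (hsub ht)
      rw [hg', Finsupp.sub_apply, Finsupp.single_eq_same, hc, h1, sub_self] at this
      exact this rfl
  have hrec := ih _ hlt f' g' hf'0 hg'0 (fun n => ?_) rfl
  · rw [hfe, hge, map_add, map_add, Finsupp.linearCombination_single,
      Finsupp.linearCombination_single, add_add_add_comm, ← smul_add]
    exact C.add_mem hrec (C.smul_mem hc0.le (hPQ j t hjt))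
  -- At or above the served level both sides drop by `c`; below it there is no demand, by minimality
  -- of `h t`.
  · by_cases hn : h t ≤ n
    · have h1 := hfg n
      rw [hfe, hge, map_add, map_add, Finsupp.linearCombination_single, cumul_single,
        if_pos hn, if_pos (hjt.trans_le hn), smul_eq_mul, mul_one] at h1
      linarith
    · have h1 : Finsupp.linearCombination ℚ (fun t => if h t ≤ n then (1 : ℚ) else 0) g' = 0 := by
        refine Finset.sum_eq_zero fun i hi => ?_
        have : ¬ h i ≤ n := fun hle => hn ((hmin i (hgs hi)).trans hle)
        simp [this]
      rw [h1]
      exact linearCombination_indicator_nonneg _ hf'0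

end Greedy

/-! ### The cone of inequalities and its pure generators -/

section DiagramCone

/-- The numerical conditions satisfied by Betti diagrams over a binary quadric. -/
noncomputable def diagramCone : PointedCone ℚ DiagramSpace where
  carrier := {v | (∀ i j, 0 ≤ v i j) ∧ (∀ j, v 2 (j + 1) ≤ v 1 j) ∧
    (∀ i j, v (i + 3) (j + 1) = v (i + 2) j) ∧
    ∀ n, 2 * cumul (n + 1) (v 1) ≤ 2 * cumul n (v 0) + cumul (n + 2) (v 2)}
  zero_mem' := by simp
  add_mem' := by
    rintro u v ⟨h1, h2, h3, h4⟩ ⟨h1', h2', h3', h4'⟩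
    refine ⟨fun i j => ?_, fun j => ?_, fun i j => ?_, fun n => ?_⟩
    · exact add_nonneg (h1 i j) (h1' i j)
    · exact add_le_add (h2 j) (h2' j)
    · simp only [Pi.add_apply, Finsupp.add_apply, h3, h3']
    · simp only [Pi.add_apply, map_add]
      linarith [h4 n, h4' n]
  smul_mem' := by
    rintro ⟨c, hc⟩ v ⟨h1, h2, h3, h4⟩
    refine ⟨fun i j => ?_, fun j => ?_, fun i j => ?_, fun n => ?_⟩
    · exact mul_nonneg hc (h1 i j)
    · exact mul_le_mul_of_nonneg_left (h2 j) hc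
    · exact congrArg (c * ·) (h3 i j)
    · change 2 * cumul (n + 1) (c • v 1) ≤ 2 * cumul n (c • v 0) + cumul (n + 2) (c • v 2)
      simp only [map_smul, smul_eq_mul]
      linarith [mul_le_mul_of_nonneg_left (h4 n) hc]

theorem mem_diagramCone {v : DiagramSpace} : v ∈ diagramCone ↔ (∀ i j, 0 ≤ v i j) ∧
    (∀ j, v 2 (j + 1) ≤ v 1 j) ∧ (∀ i j, v (i + 3) (j + 1) = v (i + 2) j) ∧
    ∀ n, 2 * cumul (n + 1) (v 1) ≤ 2 * cumul n (v 0) + cumul (n + 2) (v 2) := Iff.rfl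

/-- The normalized pure diagram of type `(d₀, d₁, ∞, …)`. -/
noncomputable def finiteDiagram (d₀ : ℤ) (d₁ : WithTop ℤ) : DiagramSpace
  | 0 => Finsupp.single d₀ 1
  | 1 => d₁.recTopCoe 0 fun j => Finsupp.single j 1
  | _ + 2 => 0

/-- The normalized pure diagram of type `(d₀, d₁, d₁ + 1, …)` with `β₁ = 2 β₀`. -/
noncomputable def infiniteDiagram (d₀ d₁ : ℤ) : DiagramSpace
  | 0 => Finsupp.single d₀ 1
  | i + 1 => Finsupp.single (d₁ + i) 2

/-- The normalized pure diagrams. -/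
def pureDiagrams : Set DiagramSpace :=
  {v | (∃ (d₀ : ℤ) (d₁ : WithTop ℤ), (d₀ : WithTop ℤ) < d₁ ∧ v = finiteDiagram d₀ d₁) ∨
    ∃ d₀ d₁ : ℤ, d₀ < d₁ ∧ v = infiniteDiagram d₀ d₁}

/-- Columns from 2 on are determined by column 2. Half of column 2, shifted back by one degree,
counts the infinite tails (entries 2), and what is left of column 1 counts the finite ones. The
fourth inequality is then the domination hypothesis of the matching lemma. -/
theorem diagramCone_le_hull : diagramCone ≤ PointedCone.hull ℚ pureDiagrams := by
  intro v hv
  obtain ⟨h1, h2, h3, h4⟩ := mem_diagramCone.1 hv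
  let P : ℤ → DiagramSpace := fun j => Pi.single 0 (Finsupp.single j 1)
  let Q : ℤ ⊕ ℤ → DiagramSpace := Sum.elim (fun j => Pi.single 1 (Finsupp.single j 1))
    (fun j i => match i with
      | 0 => 0
      | i + 1 => Finsupp.single (j + i) 2)
  let b : ℤ →₀ ℚ := (v 2).equivMapDomain (Equiv.subRight 1)
  have hb : ∀ j, b j = v 2 (j + 1) := fun j => by simp [b, Finsupp.equivMapDomain_apply]
  have hcb : ∀ n, cumul n b = cumul (n + 1) (v 2) := by
    intro n
    rw [cumul, cumul, Finsupp.linearCombination_equivMapDomain]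
    congr 2
    funext j
    simp [sub_lt_iff_lt_add]
  let g : ℤ ⊕ ℤ →₀ ℚ := Finsupp.sumElim (v 1 - b) ((1 / 2 : ℚ) • b)
  have hlc : ∀ {W : Type} [AddCommGroup W] [Module ℚ W] (R : ℤ ⊕ ℤ → W),
      Finsupp.linearCombination ℚ R g =
        Finsupp.linearCombination ℚ (R ∘ Sum.inl) (v 1 - b) +
          Finsupp.linearCombination ℚ (R ∘ Sum.inr) ((1 / 2 : ℚ) • b) := by
    intro W _ _ R
    exact Finsupp.sum_sumElim _ _ _
  have hve : v = Finsupp.linearCombination ℚ P (v 0) + Finsupp.linearCombination ℚ Q g := by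
    have hconst : ∀ (i : ℕ) (R : ℤ → DiagramSpace) (f : ℤ →₀ ℚ),
        Finsupp.linearCombination ℚ R f i = Finsupp.linearCombination ℚ (fun j => R j i) f := by
      intro i R f
      simp [Finsupp.linearCombination_apply, Finsupp.sum, Finset.sum_apply]
    have hid : ∀ f : ℤ →₀ ℚ,
        Finsupp.linearCombination ℚ (fun j => Finsupp.single j (1 : ℚ)) f = f := by
      intro f
      simp [Finsupp.linearCombination_apply, Finsupp.sum_single]
    have hshift : ∀ (f : ℤ →₀ ℚ) (i : ℕ) (j : ℤ),
        Finsupp.linearCombination ℚ (fun j => Finsupp.single (j + (i : ℤ)) (2 : ℚ)) f j =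
          2 * f (j - i) := by
      intro f i j
      rw [Finsupp.linearCombination_apply, Finsupp.sum, Finsupp.finsetSum_apply,
        Finset.sum_eq_single (j - i)]
      · simp [mul_comm]
      · intro j' _ hne
        rw [Finsupp.smul_apply, Finsupp.single_eq_of_ne (by omega), smul_zero]
      · intro h
        rw [Finsupp.notMem_support_iff.1 h, zero_smul]; rfl
    have hv2 : ∀ (i : ℕ) (j : ℤ), v (i + 2) (j + i) = v 2 j := by
      intro i
      induction i with
      | zero => simp
      | succ i ih =>
        intro j
        rw [← ih j, ← h3 i (j + i)]
        congr 1
        push_cast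
        ring
    funext i
    rw [hlc, Pi.add_apply, Pi.add_apply, hconst, hconst, hconst]
    simp only [Function.comp_apply, P, Q, Sum.elim_inl, Sum.elim_inr]
    rcases i with _ | _ | i
    · simp only [Pi.single_eq_same]
      rw [hid]
      ext j
      simp [Finsupp.linearCombination_apply]
    · ext j
      simp only [zero_add, Pi.single_eq_same, Finsupp.add_apply]
      rw [hid, hshift]
      simp [Finsupp.linearCombination_apply, Finsupp.sub_apply]
    · ext j
      rw [Finsupp.add_apply, Finsupp.add_apply, hshift]
      have h5 := hv2 i (j - i)
      rw [sub_add_cancel] at h5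
      rw [h5]
      simp only [Finsupp.smul_apply, hb]
      simp [Finsupp.linearCombination_apply]
      congr 1
      ring
  rw [hve]
  refine linearCombination_add_mem_of_dominated _ (h := Sum.elim id id) ?_ ?_ (v 0) g (h1 0) ?_ ?_
  · intro j
    refine PointedCone.subset_hull (Or.inl ⟨j, ⊤, WithTop.coe_lt_top j, ?_⟩)
    funext i
    rcases i with _ | _ | i <;> simp [P, finiteDiagram]
  · rintro j (t | t) hjt
    · refine PointedCone.subset_hull (Or.inl ⟨j, t, WithTop.coe_lt_coe.2 hjt, ?_⟩)
      funext i
      rcases i with _ | _ | i <;> simp [P, Q, finiteDiagram]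
    · refine PointedCone.subset_hull (Or.inr ⟨j, t, hjt, ?_⟩)
      funext i
      rcases i with _ | i <;> simp [P, Q, infiniteDiagram]
  · rintro (t | t)
    · simp [g, hb, h2]
    · simp [g, hb, h1]
  · intro n
    have hl : (fun t : ℤ ⊕ ℤ => if Sum.elim id id t ≤ n then (1 : ℚ) else 0) ∘ Sum.inl =
        fun t => if t < n + 1 then 1 else 0 := by
      exact funext fun t => if_congr Int.lt_add_one_iff.symm rfl rfl
    have hr : (fun t : ℤ ⊕ ℤ => if Sum.elim id id t ≤ n then (1 : ℚ) else 0) ∘ Sum.inr =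
        fun t => if t < n + 1 then 1 else 0 := by
      exact funext fun t => if_congr Int.lt_add_one_iff.symm rfl rfl
    rw [hlc, hl, hr]
    change cumul (n + 1) _ + cumul (n + 1) _ ≤ _
    rw [map_sub, map_smul, hcb, smul_eq_mul]
    have h6 := h4 n
    rw [show n + 2 = n + 1 + 1 by ring] at h6
    linarith

theorem pureDiagrams_subset : pureDiagrams ⊆ diagramCone := by
  rintro v (⟨d₀, d₁, hlt, rfl⟩ | ⟨d₀, d₁, hlt, rfl⟩)
  · refine mem_diagramCone.2 ⟨?_, ?_, ?_, ?_⟩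
    · rintro (_ | _ | i) j
      · simp only [finiteDiagram, Finsupp.single_apply]; split_ifs <;> norm_num
      · induction d₁ using WithTop.recTopCoe with
        | top => simp [finiteDiagram]
        | coe d => simp only [finiteDiagram, WithTop.recTopCoe_coe, Finsupp.single_apply]
                   split_ifs <;> norm_num
      · simp [finiteDiagram]
    · intro j
      induction d₁ using WithTop.recTopCoe with
      | top => simp [finiteDiagram]
      | coe d => simp only [finiteDiagram, WithTop.recTopCoe_coe, Finsupp.single_apply]
                 split_ifs <;> norm_num
    · intro i j
      simp [finiteDiagram]
    · intro n
      induction d₁ using WithTop.recTopCoe with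
      | top => simp only [finiteDiagram, cumul_single, WithTop.recTopCoe_top, map_zero]
               split_ifs <;> norm_num
      | coe d =>
        have := WithTop.coe_lt_coe.1 hlt
        simp only [finiteDiagram, cumul_single, WithTop.recTopCoe_coe, map_zero]
        split_ifs <;> first | omega | norm_num
  · refine mem_diagramCone.2 ⟨?_, ?_, ?_, ?_⟩
    · rintro (_ | i) j
      · simp only [infiniteDiagram, Finsupp.single_apply]; split_ifs <;> norm_num
      · simp only [infiniteDiagram, Finsupp.single_apply]; split_ifs <;> norm_num
    · intro j
      simp only [infiniteDiagram, Finsupp.single_apply]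
      push_cast
      split_ifs <;> first | omega | norm_num
    · intro i j
      simp only [infiniteDiagram, Finsupp.single_apply]
      push_cast
      split_ifs <;> first | omega | norm_num
    · intro n
      simp only [infiniteDiagram, cumul_single]
      push_cast
      split_ifs <;> first | omega | norm_num

theorem hull_pureDiagrams : PointedCone.hull ℚ pureDiagrams = diagramCone :=
  le_antisymm (Submodule.span_le.2 pureDiagrams_subset) diagramCone_le_hull

end DiagramCone

/-! ### Extremal rays -/

section Extremal

theorem mem_ray {v w : DiagramSpace} : w ∈ ray v ↔ ∃ c : ℚ, 0 ≤ c ∧ w = c • v := by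
  rw [ray, Submodule.mem_span_singleton]
  constructor
  · rintro ⟨⟨c, hc⟩, rfl⟩
    exact ⟨c, hc, rfl⟩
  · rintro ⟨c, hc, rfl⟩
    exact ⟨⟨c, hc⟩, rfl⟩

theorem ray_smul {v : DiagramSpace} {c : ℚ} (hc : 0 < c) : ray (c • v) = ray v := by
  ext w
  rw [mem_ray, mem_ray]
  constructor
  · rintro ⟨d, hd, rfl⟩
    exact ⟨d * c, mul_nonneg hd hc.le, smul_smul _ _ _⟩
  · rintro ⟨d, hd, rfl⟩
    exact ⟨d * c⁻¹, mul_nonneg hd (inv_nonneg.2 hc.le), by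
      rw [smul_smul, inv_mul_cancel_right₀ hc.ne']⟩

theorem isExtremalRay_of_forall_add {C : PointedCone ℚ DiagramSpace} {v : DiagramSpace}
    (hv0 : v ≠ 0) (hv : v ∈ C)
    (h : ∀ u ∈ C, ∀ y ∈ C, ∀ c : ℚ, u + y = c • v → ∃ c' : ℚ, 0 ≤ c' ∧ u = c' • v) :
    IsExtremalRay C (ray v) := by
  refine ⟨⟨v, hv0, rfl⟩, ?_, ?_⟩
  · exact Submodule.span_le.2 (Set.singleton_subset_iff.2 hv)
  · intro x y a hx hy ha hxy
    obtain ⟨c, -, hc⟩ := mem_ray.1 hxy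
    obtain ⟨c', hc', hu⟩ := h (a • x) (C.smul_mem ha.le hx) y hy c hc
    refine mem_ray.2 ⟨a⁻¹ * c', mul_nonneg (inv_nonneg.2 ha.le) hc', ?_⟩
    rw [mul_smul, ← hu, smul_smul, inv_mul_cancel₀ ha.ne', one_smul]

theorem Finsupp.eq_single_of_add_eq_single {f g : ℤ →₀ ℚ} (hf : ∀ j, 0 ≤ f j) (hg : ∀ j, 0 ≤ g j)
    {d : ℤ} {c : ℚ} (h : f + g = Finsupp.single d c) : f = Finsupp.single d (f d) := by
  ext j
  by_cases hj : j = d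
  · rw [hj, Finsupp.single_eq_same]
  · have := DFunLike.congr_fun h j
    rw [Finsupp.add_apply, Finsupp.single_eq_of_ne hj] at this
    rw [Finsupp.single_eq_of_ne hj]
    linarith [hf j, hg j]

theorem Finsupp.eq_zero_of_add_eq_zero_of_nonneg {f g : ℤ →₀ ℚ} (hf : ∀ j, 0 ≤ f j)
    (hg : ∀ j, 0 ≤ g j) (h : f + g = 0) : f = 0 := by
  have h1 : f + g = Finsupp.single 0 0 := by rw [h, Finsupp.single_zero]
  ext j
  have := DFunLike.congr_fun h j
  rw [Finsupp.add_apply, Finsupp.zero_apply] at this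
  rw [Finsupp.zero_apply]
  linarith [hf j, hg j]

/-- Summands have the same support by nonnegativity. For finite `d₁`, the rank inequality gives `β₁
≤ β₀` for each summand, and equality for the sum forces equality for both. -/
theorem isExtremalRay_finiteDiagram {d₀ : ℤ} {d₁ : WithTop ℤ} (hlt : (d₀ : WithTop ℤ) < d₁) :
    IsExtremalRay diagramCone (ray (finiteDiagram d₀ d₁)) := by
  refine isExtremalRay_of_forall_add (fun h => ?_) (pureDiagrams_subset (Or.inl ⟨d₀, d₁, hlt, rfl⟩))
    fun u hu y hy c huy => ?_
  · have := DFunLike.congr_fun (congrFun h 0) d₀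
    simp [finiteDiagram] at this
  obtain ⟨h1, -, -, h4⟩ := mem_diagramCone.1 hu
  obtain ⟨h1', -, -, h4'⟩ := mem_diagramCone.1 hy
  have e0 : u 0 + y 0 = Finsupp.single d₀ c := by
    rw [← Pi.add_apply, huy]; simp [finiteDiagram]
  have e2 : ∀ i, u (i + 2) + y (i + 2) = 0 := fun i => by
    rw [← Pi.add_apply, huy]; simp [finiteDiagram]
  have u0 := Finsupp.eq_single_of_add_eq_single (h1 0) (h1' 0) e0
  have y0 := Finsupp.eq_single_of_add_eq_single (h1' 0) (h1 0) (by rw [add_comm, e0])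
  have u2 := fun i => Finsupp.eq_zero_of_add_eq_zero_of_nonneg (h1 _) (h1' _) (e2 i)
  have y2 := fun i => Finsupp.eq_zero_of_add_eq_zero_of_nonneg (h1' _) (h1 _)
    (by rw [add_comm, e2 i])
  refine ⟨u 0 d₀, h1 _ _, ?_⟩
  induction d₁ using WithTop.recTopCoe with
  | top =>
    have e1 : u 1 + y 1 = 0 := by rw [← Pi.add_apply, huy]; simp [finiteDiagram]
    have u1 := Finsupp.eq_zero_of_add_eq_zero_of_nonneg (h1 _) (h1' _) e1
    funext i
    rcases i with _ | _ | i
    · conv_lhs => rw [u0]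
      simp [finiteDiagram]
    · simp [u1, finiteDiagram]
    · simp [u2 i, finiteDiagram]
  | coe d =>
    have e1 : u 1 + y 1 = Finsupp.single d c := by
      rw [← Pi.add_apply, huy]; simp [finiteDiagram]
    have u1 := Finsupp.eq_single_of_add_eq_single (h1 1) (h1' 1) e1
    have y1 := Finsupp.eq_single_of_add_eq_single (h1' 1) (h1 1) (by rw [add_comm, e1])
    have hd := WithTop.coe_lt_coe.1 hlt
    have a1 := h4 d
    have a2 := h4' d
    rw [u0, u1, u2 0, cumul_single, cumul_single, map_zero, if_pos (by omega), if_pos hd] at a1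
    rw [y0, y1, y2 0, cumul_single, cumul_single, map_zero, if_pos (by omega), if_pos hd] at a2
    have a3 := DFunLike.congr_fun e0 d₀
    have a4 := DFunLike.congr_fun e1 d
    simp only [Finsupp.add_apply, Finsupp.single_eq_same] at a3 a4
    have a5 : u 1 d = u 0 d₀ := by linarith
    funext i
    rcases i with _ | _ | i
    · conv_lhs => rw [u0]
      simp [finiteDiagram]
    · conv_lhs => rw [zero_add, u1, a5]
      simp [finiteDiagram]
    · simp [u2 i, finiteDiagram]

/-- Both `β₂ ≤ β₁` and `2β₁ ≤ 2β₀ + β₂` are equalities for the sum, hence for each summand, which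
leaves one free parameter. -/
theorem isExtremalRay_infiniteDiagram {d₀ d₁ : ℤ} (hlt : d₀ < d₁) :
    IsExtremalRay diagramCone (ray (infiniteDiagram d₀ d₁)) := by
  refine isExtremalRay_of_forall_add (fun h => ?_) (pureDiagrams_subset (Or.inr ⟨d₀, d₁, hlt, rfl⟩))
    fun u hu y hy c huy => ?_
  · have := DFunLike.congr_fun (congrFun h 0) d₀
    simp [infiniteDiagram] at this
  obtain ⟨h1, h2, h3, h4⟩ := mem_diagramCone.1 hu
  obtain ⟨h1', h2', h3', h4'⟩ := mem_diagramCone.1 hy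
  have e0 : u 0 + y 0 = Finsupp.single d₀ c := by
    rw [← Pi.add_apply, huy]; simp [infiniteDiagram]
  have e1 : ∀ i : ℕ, u (i + 1) + y (i + 1) = Finsupp.single (d₁ + i) (c * 2) := fun i => by
    rw [← Pi.add_apply, huy]; simp [infiniteDiagram]
  have u0 := Finsupp.eq_single_of_add_eq_single (h1 0) (h1' 0) e0
  have y0 := Finsupp.eq_single_of_add_eq_single (h1' 0) (h1 0) (by rw [add_comm, e0])
  have u1 := fun i => Finsupp.eq_single_of_add_eq_single (h1 _) (h1' _) (e1 i)
  have y1 := fun i => Finsupp.eq_single_of_add_eq_single (h1' _) (h1 _) (by rw [add_comm, e1 i])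
  have a1 := h4 d₁
  have a2 := h4' d₁
  have a3 := DFunLike.congr_fun e0 d₀
  have a4 := DFunLike.congr_fun (e1 0) d₁
  have a5 := DFunLike.congr_fun (e1 1) (d₁ + 1)
  have a6 := h2 d₁
  have a7 := h2' d₁
  have u1' := u1 0
  have u2' := u1 1
  have y1' := y1 0
  have y2' := y1 1
  simp only [zero_add, Nat.cast_zero, add_zero, Nat.cast_one, Finsupp.add_apply,
    Finsupp.single_eq_same, Nat.reduceAdd] at a3 a4 a5 u1' u2' y1' y2'
  rw [u0, u1', u2', cumul_single, cumul_single, cumul_single, if_pos (by omega), if_pos hlt,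
    if_pos (by omega)] at a1
  rw [y0, y1', y2', cumul_single, cumul_single, cumul_single, if_pos (by omega), if_pos hlt,
    if_pos (by omega)] at a2
  have b1 : u 1 d₁ = u 0 d₀ * 2 := by linarith
  have b2 : u 2 (d₁ + 1) = u 0 d₀ * 2 := by linarith
  have b3 : ∀ i : ℕ, u (i + 2) (d₁ + (i + 1 : ℕ)) = u 0 d₀ * 2 := by
    intro i
    induction i with
    | zero => simpa using b2
    | succ i ih =>
      rw [← ih, ← h3 i (d₁ + (i + 1 : ℕ))]
      push_cast
      rw [← add_assoc d₁ ((i : ℤ) + 1) 1]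
  refine ⟨u 0 d₀, h1 _ _, funext fun i => ?_⟩
  rcases i with _ | _ | i
  · conv_lhs => rw [u0]
    simp [infiniteDiagram]
  · conv_lhs => rw [zero_add, u1', b1]
    simp [infiniteDiagram]
  · conv_lhs => rw [u1 (i + 1), b3]
    simp [infiniteDiagram]

theorem isExtremalRay_of_mem_pureDiagrams {v : DiagramSpace} (hv : v ∈ pureDiagrams) :
    IsExtremalRay diagramCone (ray v) := by
  rcases hv with ⟨d₀, d₁, hlt, rfl⟩ | ⟨d₀, d₁, hlt, rfl⟩
  · exact isExtremalRay_finiteDiagram hlt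
  · exact isExtremalRay_infiniteDiagram hlt

/-- An extremal ray of a cone is spanned by one of the generators of the cone. -/
theorem IsExtremalRay.exists_generator {S : Set DiagramSpace} {ρ : PointedCone ℚ DiagramSpace}
    (h : IsExtremalRay (PointedCone.hull ℚ S) ρ) : ∃ v ∈ S, ρ = ray v := by
  obtain ⟨⟨v, hv0, rfl⟩, hface⟩ := h
  have hv : v ∈ PointedCone.hull ℚ S := hface.le (mem_ray.2 ⟨1, zero_le_one, (one_smul _ _).symm⟩)
  obtain ⟨s, hs, c, hc, y, hy, hvy, hs0⟩ : ∃ s ∈ S, ∃ c : ℚ, 0 < c ∧ ∃ y ∈ PointedCone.hull ℚ S,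
      v = c • s + y ∧ s ≠ 0 := by
    clear hface
    induction hv using Submodule.span_induction with
    | mem x hx => exact ⟨x, hx, 1, one_pos, 0, Submodule.zero_mem _, by simp, hv0⟩
    | zero => exact absurd rfl hv0
    | add x y hx hy ihx ihy =>
      by_cases hx0 : x = 0
      · obtain ⟨s, hs, c, hc, z, hz, rfl, hs0⟩ := ihy (by rwa [hx0, zero_add] at hv0)
        exact ⟨s, hs, c, hc, z, hz, by rw [hx0, zero_add], hs0⟩
      · obtain ⟨s, hs, c, hc, z, hz, rfl, hs0⟩ := ihx hx0
        exact ⟨s, hs, c, hc, z + y, Submodule.add_mem _ hz hy, add_assoc _ _ _, hs0⟩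
    | smul a x hx ih =>
      obtain ⟨s, hs, c, hc, z, hz, rfl, hs0⟩ := ih (right_ne_zero_of_smul hv0)
      have ha : 0 < a := pos_iff_ne_zero.2 (left_ne_zero_of_smul hv0)
      refine ⟨s, hs, a * c, mul_pos ha hc, a • z, Submodule.smul_mem _ _ hz, ?_, hs0⟩
      rw [smul_add, mul_smul]
      rfl
  -- The face property puts the nonzero generator `s`, a summand of `v`, on the ray itself.
  have hmem := hface.mem_of_smul_add_mem (PointedCone.subset_hull hs) hy hc
    (mem_ray.2 ⟨1, zero_le_one, by rw [one_smul, hvy]⟩)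
  obtain ⟨d, hd, hsd⟩ := mem_ray.1 hmem
  have hd0 : 0 < d := lt_of_le_of_ne hd fun h => hs0 (by rw [hsd, ← h, zero_smul])
  exact ⟨s, hs, by rw [hsd, ray_smul hd0]⟩

end Extremal

/-! ### Projective dimension and vanishing of the free modules -/

section ProjectiveDimension

open CategoryTheory

theorem hasProjectiveDimensionLE_succ_iff_ker {R : Type u} [CommRing R] {N M : Type u}
    [AddCommGroup N] [Module R N] [AddCommGroup M] [Module R M] [Module.Projective R N]
    {f : N →ₗ[R] M} (hf : Function.Surjective f) (n : ℕ) :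
    HasProjectiveDimensionLE (ModuleCat.of R M) (n + 1) ↔
      HasProjectiveDimensionLE (ModuleCat.of R (LinearMap.ker f)) n :=
  (LinearMap.shortExact_shortComplexKer hf).hasProjectiveDimensionLT_X₃_iff n
    ((IsProjective.iff_projective N).1 inferInstance)

namespace MinimalResolution

variable {k : Type u} [Field k] {q : MvPolynomial (Fin 2) k} {M : GradedMod q}
  (F : MinimalResolution M) (Λ : LinearParameter q)

theorem fst_red_diff (i : ℕ) (v : Fin (F.rank (i + 1)) → QuadricRing q) (b : Fin (F.rank i)) :
    (Λ.red (F.diff i v b)).fst = 0 := by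
  rw [red_diff, TrivSqZeroExt.fst_inr]

theorem exists_projective_range (n i : ℕ)
    (h : HasProjectiveDimensionLE
      (ModuleCat.of (QuadricRing q) (LinearMap.range (F.diff i))) n) :
    ∃ j, Module.Projective (QuadricRing q) (LinearMap.range (F.diff j)) := by
  induction n generalizing i with
  | zero =>
    exact ⟨i, (IsProjective.iff_projective _).2 ((projective_iff_hasProjectiveDimensionLE_zero _).2 h)⟩
  | succ n ih =>
    apply ih (i + 1)
    rw [hasProjectiveDimensionLE_succ_iff_ker (F.diff i).surjective_rangeRestrict,
      LinearMap.ker_rangeRestrict, (F.exact_succ i).linearMap_ker_eq] at h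
    exact h

/-- If an image of the differential is projective, then a later free module vanishes. -/
theorem rank_eq_zero_of_projective_range (Λ : LinearParameter q) (j : ℕ)
    (h : Module.Projective (QuadricRing q) (LinearMap.range (F.diff j))) :
    F.rank (j + 2) = 0 := by
  obtain ⟨σ, hσ⟩ := Module.projective_lifting_property (F.diff j).rangeRestrict LinearMap.id
    (F.diff j).surjective_rangeRestrict
  -- The idempotent onto the kernel of `d_j`, obtained from a splitting.
  let e : (Fin (F.rank (j + 1)) → QuadricRing q) →ₗ[QuadricRing q]
      (Fin (F.rank (j + 1)) → QuadricRing q) := LinearMap.id - σ ∘ₗ (F.diff j).rangeRestrict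
  have he1 : ∀ v, F.diff j (e v) = 0 := by
    intro v
    have h1 := LinearMap.congr_fun hσ ((F.diff j).rangeRestrict v)
    have h2 := congrArg Subtype.val h1
    simp only [LinearMap.comp_apply, LinearMap.id_apply] at h2
    rw [LinearMap.codRestrict_apply, LinearMap.codRestrict_apply] at h2
    simp only [e, LinearMap.sub_apply, LinearMap.id_apply, LinearMap.comp_apply, map_sub]
    rw [h2, sub_self]
  have he2 : ∀ v, F.diff j v = 0 → e v = v := by
    intro v hv
    have : (F.diff j).rangeRestrict v = 0 := Subtype.ext hv
    simp [e, this]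
  have hee : ∀ v, e (e v) = e v := fun v => he2 _ (he1 v)
  have hfst : ∀ v a, (Λ.red (e v a)).fst = 0 := by
    intro v a
    obtain ⟨u, hu⟩ := (F.exact_succ j _).1 (he1 v)
    rw [← hu, fst_red_diff]
  -- The image of `e` consists of boundaries, which are multiples of `ε` modulo `l`; thus `e = e ∘
  -- e` vanishes modulo `l` because `ε² = 0`. Iterating makes `e` divisible by every power of `l`,
  -- so `e = 0`.
  have hred : ∀ v a, Λ.red (e v a) = 0 := by
    intro v a
    rw [← hee v, LinearMap.pi_apply_eq_sum_univ e (e v), Finset.sum_apply, map_sum]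
    refine Finset.sum_eq_zero fun b _ => ?_
    rw [Pi.smul_apply, smul_eq_mul, map_mul]
    refine TrivSqZeroExt.ext ?_ ?_
    · rw [TrivSqZeroExt.fst_mul, hfst, zero_mul, TrivSqZeroExt.fst_zero]
    · rw [DualNumber.snd_mul, hfst, hfst, zero_mul, mul_zero, add_zero, TrivSqZeroExt.snd_zero]
  have hpow : ∀ n v, ∃ w, e v = Λ.param ^ n • e w := by
    intro n
    induction n with
    | zero => exact fun v => ⟨v, by rw [pow_zero, one_smul]⟩
    | succ n ih =>
      intro v
      obtain ⟨w, hw⟩ := ih v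
      obtain ⟨w', hw'⟩ := Λ.exists_eq_param_smul _ (hred w)
      exact ⟨w', by rw [hw, ← hee w, hw', map_smul, smul_smul, pow_succ]⟩
  have he0 : ∀ v, e v = 0 := by
    intro v
    funext a
    refine Λ.eq_zero_of_forall_pow_dvd _ fun n => ?_
    obtain ⟨w, hw⟩ := hpow n v
    exact ⟨e w a, congrFun hw a⟩
  have hd0 : ∀ v, F.diff (j + 1) v = 0 := fun v => by
    rw [← he2 _ (F.diff_diff j v), he0]
  -- Now `d_{j+1} = 0`, so a basis vector of `F_{j+2}` would be a boundary, contradicting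
  -- minimality.
  by_contra hne
  let b : Fin (F.rank (j + 2)) := ⟨0, Nat.pos_of_ne_zero hne⟩
  obtain ⟨z, hz⟩ := (F.exact_succ (j + 1) (Pi.single b 1)).1 (hd0 _)
  have h1 := F.fst_red_diff Λ (j + 2) z b
  rw [hz, Pi.single_eq_same, map_one, TrivSqZeroExt.fst_one] at h1
  exact one_ne_zero h1

theorem not_hasFiniteProjDim (Λ : LinearParameter q) (h : ∀ i, F.rank i ≠ 0) :
    ¬ M.HasFiniteProjDim := by
  rintro ⟨n, hn⟩
  have hn' : HasProjectiveDimensionLE (ModuleCat.of (QuadricRing q) M.carrier) (n + 1) :=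
    hasProjectiveDimensionLT_of_ge _ (n + 1) _ (by omega)
  rw [hasProjectiveDimensionLE_succ_iff_ker F.aug_surjective, F.exact_zero.linearMap_ker_eq] at hn'
  obtain ⟨j, hj⟩ := F.exists_projective_range n 0 hn'
  exact h _ (F.rank_eq_zero_of_projective_range Λ j hj)

theorem diff_zero_injective (h : F.rank 2 = 0) : Function.Injective (F.diff 0) := by
  rw [← LinearMap.ker_eq_bot, LinearMap.ker_eq_bot']
  intro v hv
  obtain ⟨z, rfl⟩ := (F.exact_succ 0 v).1 hv
  have : z = 0 := funext fun a => (Fin.cast h a).elim0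
  rw [this, map_zero]

theorem hasFiniteProjDim (h : F.rank 2 = 0) : M.HasFiniteProjDim := by
  refine ⟨1, ?_⟩
  rw [hasProjectiveDimensionLE_succ_iff_ker F.aug_surjective, F.exact_zero.linearMap_ker_eq,
    ← projective_iff_hasProjectiveDimensionLE_zero]
  have := Module.Projective.of_equiv (LinearEquiv.ofInjective _ (F.diff_zero_injective h))
  exact (IsProjective.iff_projective _).1 this

end MinimalResolution

end ProjectiveDimension

/-! ### Depth and Krull dimension -/

section Dimension

/-- Each regular element avoids the minimal primes of the support, so each quotient lowers the
dimension by at least one. -/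
theorem length_le_supportDim {R : Type*} [CommRing R] (rs : List R) {M : Type*} [AddCommGroup M]
    [Module R M] [Module.Finite R M] (h : RingTheory.Sequence.IsRegular M rs) :
    ((rs.length : ℕ∞) : WithBot ℕ∞) ≤ Module.supportDim R M := by
  induction rs generalizing M with
  | nil =>
    have : Nontrivial M := by
      by_contra hn
      rw [not_nontrivial_iff_subsingleton] at hn
      exact h.top_ne_smul (Subsingleton.elim _ _)
    have h1 := Module.supportDim_ne_bot_of_nontrivial R M
    rw [List.length_nil, Nat.cast_zero]
    induction hd : Module.supportDim R M with
    | bot => exact absurd hd h1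
    | coe d => exact WithBot.coe_le_coe.2 zero_le
  | cons r rs ih =>
    obtain ⟨hr, hrs⟩ := (RingTheory.Sequence.isRegular_cons_iff M r rs).1 h
    refine le_trans ?_ (Module.supportDim_quotSMulTop_succ_le_of_notMem_minimalPrimes
      fun p => hr.notMem_of_mem_minimalPrimes)
    have := add_le_add_left (ih hrs) 1
    simpa using this

variable {k : Type u} [Field k] {q : MvPolynomial (Fin 2) k}

theorem GradedMod.depth_le_supportDim (M : GradedMod q) [Nontrivial M.carrier] :
    (M.depth : WithBot ℕ∞) ≤ Module.supportDim (QuadricRing q) M.carrier := by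
  have h1 := Module.supportDim_ne_bot_of_nontrivial (QuadricRing q) M.carrier
  have h2 := fun rs => length_le_supportDim (R := QuadricRing q) rs (M := M.carrier)
  induction hd : Module.supportDim (QuadricRing q) M.carrier with
  | bot => exact absurd hd h1
  | coe d =>
    rw [hd] at h2
    exact WithBot.coe_le_coe.2 (iSup_le fun rs => iSup_le fun _ => iSup_le fun h =>
      WithBot.coe_le_coe.1 (h2 rs h))

theorem ringKrullDim_quadricRing_le (hq0 : q ≠ 0) : ringKrullDim (QuadricRing q) ≤ 1 := by
  have h1 := ringKrullDim_quotient_succ_le_of_nonZeroDivisor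
    (mem_nonZeroDivisors_of_ne_zero hq0)
  rw [MvPolynomial.ringKrullDim_of_isNoetherianRing, ringKrullDim_eq_zero_of_field] at h1
  induction hd : ringKrullDim (QuadricRing q) with
  | bot => exact bot_le
  | coe d =>
    rw [hd] at h1
    have h2 : d + 1 ≤ 1 + 1 := by
      have : ((d + 1 : ℕ∞) : WithBot ℕ∞) ≤ ((1 + 1 : ℕ∞) : WithBot ℕ∞) := by
        refine le_trans h1 (le_of_eq ?_)
        simp; norm_num
      exact WithBot.coe_le_coe.1 this
    exact WithBot.coe_le_coe.2 ((ENat.add_le_add_iff_right ENat.one_ne_top).1 h2)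

theorem LinearParameter.pow_mem_nonZeroDivisors (Λ : LinearParameter q) (e : ℕ) :
    Λ.param ^ e ∈ nonZeroDivisors (QuadricRing q) :=
  pow_mem (mem_nonZeroDivisors_iff.2 ⟨Λ.eq_zero_of_param_mul, fun r hr =>
    Λ.eq_zero_of_param_mul r (by rw [mul_comm, hr])⟩) e

theorem LinearParameter.ringKrullDim_quotient_le (Λ : LinearParameter q) (hq0 : q ≠ 0) {e : ℕ}
    {I : Ideal (QuadricRing q)} (hI : Λ.param ^ e ∈ I) : ringKrullDim (QuadricRing q ⧸ I) ≤ 0 := by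
  have h1 := (ringKrullDim_quotient_succ_le_of_nonZeroDivisor (Λ.pow_mem_nonZeroDivisors e)).trans
    (ringKrullDim_quadricRing_le hq0)
  have h2 : ringKrullDim (QuadricRing q ⧸ I) ≤
      ringKrullDim (QuadricRing q ⧸ Ideal.span {Λ.param ^ e}) :=
    ringKrullDim_le_of_surjective
      (Ideal.Quotient.factor ((Ideal.span_singleton_le_iff_mem I).2 hI))
      (Ideal.Quotient.factor_surjective _)
  refine h2.trans ?_
  induction hd : ringKrullDim (QuadricRing q ⧸ Ideal.span {Λ.param ^ e}) with
  | bot => exact bot_le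
  | coe d =>
    rw [hd] at h1
    have h3 : d + 1 ≤ 0 + 1 := by
      have : ((d + 1 : ℕ∞) : WithBot ℕ∞) ≤ ((0 + 1 : ℕ∞) : WithBot ℕ∞) := by
        refine le_trans h1 (le_of_eq ?_)
        simp
      exact WithBot.coe_le_coe.1 this
    exact WithBot.coe_le_coe.2 ((ENat.add_le_add_iff_right ENat.one_ne_top).1 h3)

theorem isArtinianRing_of_ringKrullDim_le {R : Type*} [CommRing R] [IsNoetherianRing R]
    (h : ringKrullDim R ≤ 0) : IsArtinianRing R :=
  isArtinianRing_iff_isNoetherianRing_krullDimLE_zero.2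
    ⟨inferInstance, Ring.krullDimLE_iff.2 (by simpa using h)⟩

end Dimension

/-! ### Modules of projective dimension one -/

namespace MinimalResolution

variable {k : Type u} [Field k] {q : MvPolynomial (Fin 2) k} {M : GradedMod q}
  (F : MinimalResolution M)

/-- A module of projective dimension one has no regular element in the irrelevant ideal. -/
theorem depth_eq_zero (Λ : LinearParameter q) (h1 : F.rank 1 ≠ 0) (h2 : F.rank 2 = 0) :
    M.depth = 0 := by
  refine nonpos_iff_eq_zero.1 (iSup_le fun rs => iSup_le fun hm => iSup_le fun hreg => ?_)
  rcases rs with _ | ⟨r, rs⟩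
  · simp
  exfalso
  have hr : IsSMulRegular M.carrier r :=
    ((RingTheory.Sequence.isRegular_cons_iff M.carrier r rs).1 hreg).1
  have hrm : r ∈ irrelevantIdeal q := hm r List.mem_cons_self
  -- A regular `r` in the irrelevant ideal reduces to a multiple of `ε`, so `r²` is a multiple of
  -- `l`; hence `l` is regular on `M` as well.
  have hparam : ∀ x : M.carrier, Λ.param • x = 0 → x = 0 := by
    intro x hx
    have hfst := Λ.fst_red_of_mem_irrelevantIdeal hrm
    obtain ⟨t, ht⟩ := Λ.dvd_of_red_eq_zero (r * r) (by
      rw [map_mul]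
      refine TrivSqZeroExt.ext ?_ ?_
      · rw [TrivSqZeroExt.fst_mul, hfst, zero_mul, TrivSqZeroExt.fst_zero]
      · rw [DualNumber.snd_mul, hfst, zero_mul, mul_zero, add_zero, TrivSqZeroExt.snd_zero])
    apply hr
    apply hr
    simp only [smul_zero]
    rw [← mul_smul, ht, mul_comm, mul_smul, hx, smul_zero]
  let a : Fin (F.rank 1) := ⟨0, Nat.pos_of_ne_zero h1⟩
  -- Regularity of `l` on `M` makes `F₁ → F₀` injective modulo `l`, yet `s` times a basis vector is
  -- a nonzero element of the kernel there.
  obtain ⟨w, hw⟩ := Λ.exists_eq_param_smul (F.diff 0 (Λ.gen • Pi.single a 1)) (fun b => by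
    rw [map_smul, Pi.smul_apply, smul_eq_mul, map_mul, Λ.red_gen]
    refine TrivSqZeroExt.ext ?_ ?_
    · simp
    · rw [DualNumber.snd_mul, fst_red_diff]; simp)
  obtain ⟨u, rfl⟩ := (F.exact_zero w).1 (hparam _ (by
    rw [← map_smul, ← hw]
    exact (F.exact_zero _).2 ⟨_, rfl⟩))
  rw [← map_smul] at hw
  have h3 := congrArg Λ.red (congrFun (F.diff_zero_injective h2 hw) a)
  rw [Pi.smul_apply, Pi.smul_apply, Pi.single_eq_same, smul_eq_mul, smul_eq_mul, mul_one, map_mul,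
    Λ.red_param, zero_mul, Λ.red_gen] at h3
  have h4 := congrArg TrivSqZeroExt.snd h3
  simp at h4

/-- A zero-dimensional module of projective dimension one has as many generators as relations. -/
theorem rank_zero_eq_rank_one (Λ : LinearParameter q)
    (hdim : Module.supportDim (QuadricRing q) M.carrier ≤ 0) (h2 : F.rank 2 = 0) :
    F.rank 0 = F.rank 1 := by
  have := Λ.red.toRingHom.domain_nontrivial
  refine le_antisymm ?_ (le_of_fin_injective _ _ (F.diff_zero_injective h2))
  rw [Module.supportDim_eq_ringKrullDim_quotient_annihilator] at hdim
  have hart := isArtinianRing_of_ringKrullDim_le hdim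
  set J := Module.annihilator (QuadricRing q) M.carrier with hJ
  obtain ⟨n, y, hy⟩ := IsArtinian.exists_pow_succ_smul_dvd (Ideal.Quotient.mk J Λ.param)
    (1 : QuadricRing q ⧸ J)
  obtain ⟨t, rfl⟩ := Ideal.Quotient.mk_surjective y
  -- The powers of `l` stabilize in the Artinian ring `R/Ann M`. The resulting annihilator is a
  -- nonzerodivisor, since `1 - l t` is one by `l`-adic separatedness. Multiplication by it on `F₀`
  -- factors through `F₁`, by an injective map.
  have hann : Λ.param ^ n * (1 - Λ.param * t) ∈ J := by
    rw [← Ideal.Quotient.eq_zero_iff_mem]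
    simp only [smul_eq_mul, mul_one] at hy
    simp only [map_mul, map_sub, map_pow, map_one]
    rw [pow_succ] at hy
    linear_combination -hy
  have hker : ∀ v, ∃ u, F.diff 0 u = (Λ.param ^ n * (1 - Λ.param * t)) • v := fun v =>
    (F.exact_zero _).1 (by rw [map_smul]; exact Module.mem_annihilator.1 hann _)
  obtain ⟨ψ, hψ⟩ := Module.projective_lifting_property (F.diff 0).rangeRestrict
    ((LinearMap.lsmul (QuadricRing q) (Fin (F.rank 0) → QuadricRing q)
      (Λ.param ^ n * (1 - Λ.param * t))).codRestrict
      (LinearMap.range (F.diff 0)) fun v => LinearMap.mem_range.2 (hker v))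
    (F.diff 0).surjective_rangeRestrict
  refine le_of_fin_injective (QuadricRing q) ψ ?_
  rw [← LinearMap.ker_eq_bot, LinearMap.ker_eq_bot']
  intro v hv
  have h1 := congrArg Subtype.val (LinearMap.congr_fun hψ v)
  rw [LinearMap.comp_apply, hv, map_zero] at h1
  have h3 : (Λ.param ^ n * (1 - Λ.param * t)) • v = 0 := h1.symm
  funext b
  have h4 : Λ.param ^ n * ((1 - Λ.param * t) * v b) = 0 := by
    rw [← mul_assoc]; exact congrFun h3 b
  have h5 : v b = Λ.param * t * v b := by
    have := (mem_nonZeroDivisors_iff.1 (Λ.pow_mem_nonZeroDivisors n)).1 _ h4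
    linear_combination this
  have h6 : ∀ m : ℕ, v b = (Λ.param * t) ^ m * v b := by
    intro m
    induction m with
    | zero => rw [pow_zero, one_mul]
    | succ m ih => rw [pow_succ, mul_assoc, ← h5]; exact ih
  refine Λ.eq_zero_of_forall_pow_dvd _ fun m => ⟨t ^ m * v b, ?_⟩
  conv_lhs => rw [h6 m]
  ring

end MinimalResolution

/-! ### Graded cyclic modules and their resolutions -/

section CyclicModules

variable {k : Type u} [Field k] {q : MvPolynomial (Fin 2) k}

theorem mem_gradedPiece_iff {n : ℤ} {r : QuadricRing q} : r ∈ gradedPiece q n ↔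
    ∃ f : MvPolynomial (Fin 2) k,
      (∀ m : ℕ, homogeneousComponent m f = if (m : ℤ) = n then f else 0) ∧
        Ideal.Quotient.mk (Ideal.span {q}) f = r := by
  rw [gradedPiece]
  split_ifs with h
  · lift n to ℕ using h
    rw [Int.toNat_natCast]
    constructor
    · rintro ⟨f, hf, rfl⟩
      refine ⟨f, fun m => ?_, rfl⟩
      rw [homogeneousComponent_of_mem hf]
      simp only [Nat.cast_inj]
    · rintro ⟨f, hf, rfl⟩
      refine ⟨f, ?_, rfl⟩
      have := hf n
      rw [if_pos rfl] at this
      rw [← this]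
      exact homogeneousComponent_mem n f
  · rw [Submodule.mem_bot]
    constructor
    · rintro rfl
      exact ⟨0, fun m => by simp, map_zero _⟩
    · rintro ⟨f, hf, rfl⟩
      rw [← sum_homogeneousComponent f, Finset.sum_eq_zero, map_zero]
      intro m _
      rw [hf m, if_neg (by omega)]

theorem gradedPiece_mul {m n : ℤ} {r t : QuadricRing q} (hr : r ∈ gradedPiece q m)
    (ht : t ∈ gradedPiece q n) : r * t ∈ gradedPiece q (m + n) := by
  rw [gradedPiece] at hr ht
  split_ifs at hr with hm
  · split_ifs at ht with hn
    · obtain ⟨f, hf, rfl⟩ := hr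
      obtain ⟨g, hg, rfl⟩ := ht
      rw [gradedPiece, if_pos (add_nonneg hm hn), Int.toNat_add hm hn]
      exact ⟨f * g, IsHomogeneous.mul hf hg, rfl⟩
    · rw [(Submodule.mem_bot _).1 ht, mul_zero]
      exact Submodule.zero_mem _
  · rw [(Submodule.mem_bot _).1 hr, zero_mul]
    exact Submodule.zero_mem _

theorem one_mem_gradedPiece : (1 : QuadricRing q) ∈ gradedPiece q 0 :=
  mk_mem_gradedPiece q (n := 0) (isHomogeneous_one (Fin 2) k)

theorem pow_mem_gradedPiece {r : QuadricRing q} (hr : r ∈ gradedPiece q 1) (n : ℕ) :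
    r ^ n ∈ gradedPiece q n := by
  induction n with
  | zero => rw [pow_zero]; exact one_mem_gradedPiece
  | succ n ih => rw [pow_succ, Nat.cast_succ]; exact gradedPiece_mul ih hr

theorem gradedPiece_one_le : ∀ r ∈ gradedPiece q 1, r ∈ irrelevantIdeal q := by
  intro r hr
  rw [gradedPiece, if_pos zero_le_one] at hr
  obtain ⟨f, hf, rfl⟩ := hr
  rw [Int.toNat_one, homogeneousSubmodule_one_eq_span_X] at hf
  induction hf using Submodule.span_induction with
  | mem x hx =>
    obtain ⟨i, rfl⟩ := hx
    exact Ideal.subset_span ⟨i, rfl⟩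
  | zero => rw [map_zero]; exact Ideal.zero_mem _
  | add x y _ _ hx hy => rw [map_add]; exact Ideal.add_mem _ hx hy
  | smul c x _ hx =>
    rw [MvPolynomial.smul_eq_C_mul]
    rw [AlgHom.toLinearMap_apply, map_mul]
    exact Ideal.mul_mem_left _ _ hx

attribute [local instance] MvPolynomial.gradedAlgebra

/-- Homogeneity is checked in the polynomial ring: the preimage of the ideal is generated by forms,
among them `q` itself. -/
theorem mk_homogeneousComponent_mem (hq : q.IsHomogeneous 2) {T : Set (QuadricRing q)}
    (hT : ∀ t ∈ T, ∃ n, t ∈ gradedPiece q n) {f : MvPolynomial (Fin 2) k}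
    (hf : Ideal.Quotient.mk (Ideal.span {q}) f ∈ Ideal.span T) (n : ℕ) :
    Ideal.Quotient.mk (Ideal.span {q}) (homogeneousComponent n f) ∈ Ideal.span T := by
  let T' : Set (MvPolynomial (Fin 2) k) :=
    {g | (∃ n, g.IsHomogeneous n) ∧ Ideal.Quotient.mk (Ideal.span {q}) g ∈ Ideal.span T}
  have hhom : (Ideal.span T').IsHomogeneous (homogeneousSubmodule (Fin 2) k) :=
    Ideal.homogeneous_span _ _ fun g hg => hg.1
  have hmap : (Ideal.span T').map (Ideal.Quotient.mk (Ideal.span {q})) = Ideal.span T := by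
    rw [Ideal.map_span]
    refine le_antisymm (Ideal.span_le.2 ?_) (Ideal.span_le.2 fun t ht => Ideal.subset_span ?_)
    · rintro _ ⟨g, hg, rfl⟩
      exact hg.2
    · obtain ⟨n, hn⟩ := hT t ht
      obtain ⟨g, hg, rfl⟩ := mem_gradedPiece_iff.1 hn
      refine ⟨g, ⟨?_, Ideal.subset_span ht⟩, rfl⟩
      rcases lt_or_ge n 0 with h0 | h0
      · refine ⟨0, ?_⟩
        have : g = 0 := by
          rw [← sum_homogeneousComponent g]
          exact Finset.sum_eq_zero fun m _ => by rw [hg m, if_neg (by omega)]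
        rw [this]
        exact isHomogeneous_zero _ _ _
      · lift n to ℕ using h0
        have := hg n
        rw [if_pos rfl] at this
        exact ⟨n, this ▸ homogeneousComponent_isHomogeneous n g⟩
  have hqT : q ∈ Ideal.span T' := Ideal.subset_span ⟨⟨2, hq⟩, by
    rw [Ideal.Quotient.eq_zero_iff_mem.2 (Ideal.mem_span_singleton_self q)]
    exact Ideal.zero_mem _⟩
  have hcomap : ∀ g, Ideal.Quotient.mk (Ideal.span {q}) g ∈ Ideal.span T ↔ g ∈ Ideal.span T' := by
    intro g
    rw [← hmap, ← Ideal.mem_comap,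
      Ideal.comap_map_of_surjective _ Ideal.Quotient.mk_surjective, ← RingHom.ker_eq_comap_bot,
      Ideal.mk_ker, sup_eq_left.2 ((Ideal.span_singleton_le_iff_mem _).2 hqT)]
  exact (hcomap _).2 (homogeneousComponent_mem_of_mem hhom ((hcomap f).1 hf) n)

/-- The graded pieces of `(R/I)(-d)`. -/
noncomputable def cyclicPiece (I : Ideal (QuadricRing q)) (d n : ℤ) :
    AddSubgroup (QuadricRing q ⧸ I) :=
  (gradedPiece q (n - d)).toAddSubgroup.map (Ideal.Quotient.mk I).toAddMonoidHom

theorem isInternal_cyclicPiece (I : Ideal (QuadricRing q)) (d : ℤ)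
    (hI : ∀ (f : MvPolynomial (Fin 2) k) (n : ℕ), Ideal.Quotient.mk (Ideal.span {q}) f ∈ I →
      Ideal.Quotient.mk (Ideal.span {q}) (homogeneousComponent n f) ∈ I) :
    DirectSum.IsInternal (cyclicPiece I d) := by
  classical
  constructor
  · rw [injective_iff_map_eq_zero]
    intro x hx
    have hrep : ∀ n, ∃ f : MvPolynomial (Fin 2) k,
        (∀ m : ℕ, homogeneousComponent m f = if (m : ℤ) = n - d then f else 0) ∧
          Ideal.Quotient.mk I (Ideal.Quotient.mk (Ideal.span {q}) f) = x n := by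
      intro n
      obtain ⟨r, hr, hrx⟩ := (x n).2
      obtain ⟨f, hf, rfl⟩ := mem_gradedPiece_iff.1 hr
      exact ⟨f, hf, hrx⟩
    choose f hf hfx using hrep
    rw [DirectSum.coeAddMonoidHom_eq_dfinsuppSum, DFinsupp.sum] at hx
    simp only [← hfx] at hx
    rw [← map_sum, ← map_sum, Ideal.Quotient.eq_zero_iff_mem] at hx
    ext n
    rw [DirectSum.zero_apply, ZeroMemClass.coe_zero]
    by_cases hn : n ∈ x.support
    · rcases lt_or_ge (n - d) 0 with h0 | h0
      · have : f n = 0 := by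
          rw [← sum_homogeneousComponent (f n)]
          exact Finset.sum_eq_zero fun m _ => by rw [hf n m, if_neg (by omega)]
        rw [← hfx, this, map_zero, map_zero]
      · have h1 := hI _ (n - d).toNat hx
        rw [map_sum, Finset.sum_eq_single n] at h1
        · rw [hf, if_pos (Int.toNat_of_nonneg h0)] at h1
          rw [← hfx, Ideal.Quotient.eq_zero_iff_mem]
          exact h1
        · intro m _ hmn
          rw [hf, if_neg]
          rw [Int.toNat_of_nonneg h0]
          omega
        · exact fun h => absurd hn h
    · rw [DFinsupp.notMem_support_iff.1 hn, ZeroMemClass.coe_zero]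
  · intro x
    obtain ⟨r, rfl⟩ := Ideal.Quotient.mk_surjective x
    obtain ⟨f, rfl⟩ := Ideal.Quotient.mk_surjective r
    rw [← sum_homogeneousComponent f, map_sum, map_sum]
    refine ⟨∑ i ∈ Finset.range (f.totalDegree + 1), DirectSum.of (fun n => cyclicPiece I d n) (i + d)
      ⟨Ideal.Quotient.mk I (Ideal.Quotient.mk (Ideal.span {q}) (homogeneousComponent i f)),
        ⟨_, ?_, rfl⟩⟩, ?_⟩
    · rw [add_sub_cancel_right]
      exact mk_mem_gradedPiece q (homogeneousComponent_isHomogeneous i f)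
    · rw [map_sum]
      exact Finset.sum_congr rfl fun i _ => DirectSum.coeAddMonoidHom_of _ _ _

/-- The cyclic graded module `(R/⟨T⟩)(-d)` for a set `T` of homogeneous elements. -/
noncomputable def cyclicMod (hq : q.IsHomogeneous 2) {T : Set (QuadricRing q)}
    (hT : ∀ t ∈ T, ∃ n, t ∈ gradedPiece q n) (d : ℤ) : GradedMod q where
  carrier := QuadricRing q ⧸ Ideal.span T
  piece := cyclicPiece (Ideal.span T) d
  isInternal := isInternal_cyclicPiece _ d fun _ n hf => mk_homogeneousComponent_mem hq hT hf n
  smul_mem := by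
    rintro m n r _ hr ⟨t, ht, rfl⟩
    refine ⟨r * t, ?_, rfl⟩
    rw [add_sub_assoc]
    exact gradedPiece_mul hr ht

theorem mk_one_mem_cyclicPiece (I : Ideal (QuadricRing q)) (d : ℤ) :
    Ideal.Quotient.mk I 1 ∈ cyclicPiece I d d := by
  refine ⟨1, ?_, rfl⟩
  rw [sub_self]
  exact one_mem_gradedPiece

/-- The augmentation of a cyclic module. -/
noncomputable def cyclicAug (I : Ideal (QuadricRing q)) :
    (Fin 1 → QuadricRing q) →ₗ[QuadricRing q] QuadricRing q ⧸ I :=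
  I.mkQ ∘ₗ LinearMap.proj 0

theorem cyclicAug_surjective (I : Ideal (QuadricRing q)) : Function.Surjective (cyclicAug I) :=
  I.mkQ_surjective.comp fun r => ⟨fun _ => r, rfl⟩

theorem cyclicAug_eq_zero_iff (I : Ideal (QuadricRing q)) (v : Fin 1 → QuadricRing q) :
    cyclicAug I v = 0 ↔ v 0 ∈ I :=
  Submodule.Quotient.mk_eq_zero I

theorem cyclicAug_single_mem (I : Ideal (QuadricRing q)) (d : ℤ) (a : Fin 1) :
    cyclicAug I (Pi.single a 1) ∈ cyclicPiece I d d := by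
  have : cyclicAug I (Pi.single a 1) = Ideal.Quotient.mk I 1 := by
    rw [Subsingleton.elim a 0]
    change Ideal.Quotient.mk I ((Pi.single 0 1 : Fin 1 → QuadricRing q) 0) = _
    rw [Pi.single_eq_same]
  rw [this]
  exact mk_one_mem_cyclicPiece I d

/-- The differential with image the ideal generated by the family `g`. -/
noncomputable def rowMap {n : ℕ} (g : Fin n → QuadricRing q) :
    (Fin n → QuadricRing q) →ₗ[QuadricRing q] (Fin 1 → QuadricRing q) :=
  LinearMap.pi fun _ => Fintype.linearCombination (QuadricRing q) g

theorem rowMap_apply {n : ℕ} (g v : Fin n → QuadricRing q) (b : Fin 1) :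
    rowMap g v b = ∑ a, v a * g a := rfl

theorem rowMap_single {n : ℕ} (g : Fin n → QuadricRing q) (a : Fin n) (b : Fin 1) :
    rowMap g (Pi.single a 1) b = g a := by
  rw [rowMap, LinearMap.pi_apply, Fintype.linearCombination_apply_single, one_smul]

theorem exact_rowMap {n : ℕ} (g : Fin n → QuadricRing q) :
    Function.Exact (rowMap g) (cyclicAug (Ideal.span (Set.range g))) := by
  intro v
  rw [cyclicAug_eq_zero_iff]
  refine Iff.trans (Submodule.mem_span_range_iff_exists_fun (QuadricRing q)) ?_
  constructor
  · rintro ⟨c, hc⟩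
    exact ⟨c, funext fun b => by rw [Subsingleton.elim b 0, rowMap_apply, ← hc]; rfl⟩
  · rintro ⟨c, rfl⟩
    exact ⟨c, rfl⟩

/-- The resolution of a graded free module of rank one. -/
noncomputable def freeResolution (hq : q.IsHomogeneous 2) (d : ℤ) :
    MinimalResolution (cyclicMod hq (T := Set.range (Fin.elim0 : Fin 0 → QuadricRing q))
      (by rintro _ ⟨a, -⟩; exact a.elim0) d) where
  rank i := match i with
    | 0 => 1
    | _ + 1 => 0
  deg _ _ := d
  aug := cyclicAug (Ideal.span (Set.range (Fin.elim0 : Fin 0 → QuadricRing q)))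
  diff i := match i with
    | 0 => rowMap Fin.elim0
    | _ + 1 => 0
  aug_homogeneous := cyclicAug_single_mem _ d
  diff_homogeneous _ a := a.elim0
  aug_surjective := cyclicAug_surjective _
  exact_zero := exact_rowMap _
  exact_succ i v := ⟨fun _ => ⟨0, funext fun a => a.elim0⟩, fun _ => by
    have : v = 0 := funext fun a => a.elim0
    rw [this, map_zero]⟩
  minimal _ a := a.elim0

theorem exact_zero_rowMap {r : QuadricRing q} (hr0 : r ∈ nonZeroDivisors (QuadricRing q)) :
    Function.Exact (0 : (Fin 0 → QuadricRing q) →ₗ[QuadricRing q] (Fin 1 → QuadricRing q))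
      (rowMap fun _ : Fin 1 => r) := by
  intro v
  constructor
  · intro h
    have h1 := congrFun h 0
    rw [rowMap_apply, Fin.sum_univ_one] at h1
    refine ⟨0, funext fun a => ?_⟩
    rw [Subsingleton.elim a 0]
    exact ((mem_nonZeroDivisors_iff.1 hr0).2 (v 0) h1).symm
  · rintro ⟨u, rfl⟩
    exact map_zero _

/-- The resolution of `(R/⟨r⟩)(-d)` for a homogeneous nonzerodivisor `r` of degree `e`. -/
noncomputable def principalResolution (hq : q.IsHomogeneous 2) (d : ℤ) {r : QuadricRing q} {e : ℤ}
    (hr : r ∈ gradedPiece q e) (hr0 : r ∈ nonZeroDivisors (QuadricRing q))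
    (hrm : r ∈ irrelevantIdeal q) :
    MinimalResolution (cyclicMod hq (T := Set.range fun _ : Fin 1 => r)
      (by rintro _ ⟨a, rfl⟩; exact ⟨e, hr⟩) d) where
  rank i := match i with
    | 0 => 1
    | 1 => 1
    | _ + 2 => 0
  deg i _ := match i with
    | 0 => d
    | _ + 1 => d + e
  aug := cyclicAug (Ideal.span (Set.range fun _ : Fin 1 => r))
  diff i := match i with
    | 0 => rowMap fun _ : Fin 1 => r
    | _ + 1 => 0
  aug_homogeneous := cyclicAug_single_mem _ d
  diff_homogeneous i a b := match i with
    | 0 => by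
      change rowMap (fun _ : Fin 1 => r) (Pi.single a 1) b ∈ gradedPiece q (d + e - d)
      rwa [rowMap_single, add_sub_cancel_left]
    | _ + 1 => a.elim0
  aug_surjective := cyclicAug_surjective _
  exact_zero := exact_rowMap _
  exact_succ i := match i with
    | 0 => exact_zero_rowMap hr0
    | _ + 1 => fun _ => ⟨fun _ => ⟨0, funext fun a => a.elim0⟩, fun _ => rfl⟩
  minimal i a b := match i with
    | 0 => by
      change rowMap (fun _ : Fin 1 => r) (Pi.single a 1) b ∈ _
      rwa [rowMap_single]
    | _ + 1 => a.elim0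

end CyclicModules

/-! ### The matrix factorization and linear tails -/

section MatrixFactorization

variable {k : Type u} [Field k] {q : MvPolynomial (Fin 2) k} (Λ : LinearParameter q)

namespace LinearParameter

/-- The matrices of the matrix factorization of `q` given by a linear parameter; the two factors
are obtained for `η = 1` and `η = -1`. -/
noncomputable def factor (η : QuadricRing q) : Matrix (Fin 2) (Fin 2) (QuadricRing q) :=
  !![Λ.gen, η * Λ.cofactor; η * Λ.param, Λ.gen]

theorem factor_mulVec_zero (η : QuadricRing q) (v : Fin 2 → QuadricRing q) :
    (Λ.factor η).mulVec v 0 = Λ.gen * v 0 + η * Λ.cofactor * v 1 := by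
  simp [factor, Matrix.mulVec, dotProduct, Fin.sum_univ_two]

theorem factor_mulVec_one (η : QuadricRing q) (v : Fin 2 → QuadricRing q) :
    (Λ.factor η).mulVec v 1 = η * Λ.param * v 0 + Λ.gen * v 1 := by
  simp [factor, Matrix.mulVec, dotProduct, Fin.sum_univ_two]

/-- Only the bottom row is needed for exactness. Since `powGen` is `l^e` times that row for `η = 1`,
the same lemma also treats the first step of the resolution. -/
theorem exists_factor_mulVec_eq {η θ : QuadricRing q} (hη : η * η = 1) (hθ : η + θ = 0)
    (v : Fin 2 → QuadricRing q) (h : η * Λ.param * v 0 + Λ.gen * v 1 = 0) :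
    ∃ u, (Λ.factor θ).mulVec u = v := by
  have h1 := congrArg Λ.red h
  rw [map_add, map_mul, map_mul, map_mul, Λ.red_param, mul_zero, zero_mul, zero_add, Λ.red_gen,
    map_zero] at h1
  have h2 : (Λ.red (v 1)).fst = 0 := by
    have := congrArg TrivSqZeroExt.snd h1
    simpa [DualNumber.snd_mul] using this
  set x : QuadricRing q := algebraMap k _ (Λ.red (v 1)).snd with hx
  -- Modulo `l` the equation reads `ε · v₁ = 0`, so `v₁ = x s + l w` with `x` a scalar. Substituting
  -- and cancelling `l` determines `v₀`.
  obtain ⟨w, hw⟩ := Λ.dvd_of_red_eq_zero (v 1 - x * Λ.gen) (by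
    rw [map_sub, map_mul, hx, AlgHom.commutes, Λ.red_gen, ← Algebra.smul_def,
      ← DualNumber.inr_eq_smul_eps]
    refine TrivSqZeroExt.ext ?_ ?_
    · simp [h2]
    · simp)
  have h3 : η * v 0 + x * Λ.cofactor + Λ.gen * w = 0 := by
    apply Λ.eq_zero_of_param_mul
    linear_combination h - Λ.gen * hw - x * Λ.gen_mul_gen
  refine ⟨![θ * w, x], funext fun i => ?_⟩
  fin_cases i
  · simp only [Fin.zero_eta, factor_mulVec_zero, Matrix.cons_val_zero, Matrix.cons_val_one,
      Matrix.cons_val_fin_one]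
    linear_combination θ * h3 + v 0 * hη - η * v 0 * hθ
  · simp only [Fin.mk_one, factor_mulVec_one, Matrix.cons_val_zero, Matrix.cons_val_one,
      Matrix.cons_val_fin_one]
    linear_combination (Λ.param * w) * hη - hw + Λ.param * w * (θ - η) * hθ

theorem factor_mulVec_factor {η θ : QuadricRing q} (hη : η * η = 1) (hθ : η + θ = 0)
    (v : Fin 2 → QuadricRing q) : (Λ.factor η).mulVec ((Λ.factor θ).mulVec v) = 0 := by
  funext i
  fin_cases i
  · simp only [Fin.zero_eta, factor_mulVec_zero, factor_mulVec_one, Pi.zero_apply]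
    linear_combination (-(Λ.cofactor * Λ.param * v 0)) * hη + v 0 * Λ.gen_mul_gen +
      (Λ.gen * Λ.cofactor * v 1 + η * Λ.cofactor * Λ.param * v 0) * hθ
  · simp only [Fin.mk_one, factor_mulVec_zero, factor_mulVec_one, Pi.zero_apply]
    linear_combination (-(Λ.cofactor * Λ.param * v 1)) * hη + v 1 * Λ.gen_mul_gen +
      (Λ.gen * Λ.param * v 0 + η * Λ.cofactor * Λ.param * v 1) * hθ

/-- The signs `(-1) ^ n` in `R`. -/
noncomputable def _root_.quadricSign (q : MvPolynomial (Fin 2) k) (n : ℕ) : QuadricRing q :=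
  algebraMap k _ ((-1) ^ n)

theorem _root_.quadricSign_mul_self (n : ℕ) : quadricSign q n * quadricSign q n = 1 := by
  rw [quadricSign, ← map_mul, ← mul_pow, neg_one_mul, neg_neg, one_pow, map_one]

theorem _root_.quadricSign_add_succ (n : ℕ) : quadricSign q n + quadricSign q (n + 1) = 0 := by
  rw [quadricSign, quadricSign, ← map_add, pow_succ, mul_neg_one, add_neg_cancel, map_zero]

theorem factor_mem_gradedPiece (n : ℕ) (a b : Fin 2) :
    Λ.factor (quadricSign q n) b a ∈ gradedPiece q 1 := by
  have hmul : ∀ r ∈ gradedPiece q 1, quadricSign q n * r ∈ gradedPiece q 1 := by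
    intro r hr
    have h0 : quadricSign q n ∈ gradedPiece q 0 :=
      mk_mem_gradedPiece q (n := 0) (isHomogeneous_C (Fin 2) ((-1 : k) ^ n))
    exact gradedPiece_mul h0 hr
  fin_cases a <;> fin_cases b
  · exact Λ.gen_mem
  · exact hmul _ Λ.param_mem
  · exact hmul _ Λ.cofactor_mem
  · exact Λ.gen_mem

/-- The homogeneous generators of the ideal `param ^ e • ⟨param, gen⟩`. -/
noncomputable def powGen (e : ℕ) : Fin 2 → QuadricRing q := ![Λ.param ^ e * Λ.param, Λ.param ^ e * Λ.gen]

theorem powGen_mem (e : ℕ) (a : Fin 2) : Λ.powGen e a ∈ gradedPiece q (e + 1) := by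
  fin_cases a
  · exact gradedPiece_mul (pow_mem_gradedPiece Λ.param_mem e) Λ.param_mem
  · exact gradedPiece_mul (pow_mem_gradedPiece Λ.param_mem e) Λ.gen_mem

theorem powGen_mem_irrelevantIdeal (e : ℕ) (a : Fin 2) : Λ.powGen e a ∈ irrelevantIdeal q := by
  fin_cases a
  · exact Ideal.mul_mem_left _ _ (gradedPiece_one_le _ Λ.param_mem)
  · exact Ideal.mul_mem_left _ _ (gradedPiece_one_le _ Λ.gen_mem)

theorem exact_factor_rowMap (e : ℕ) :
    Function.Exact (Λ.factor (quadricSign q 1)).mulVecLin (rowMap (Λ.powGen e)) := by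
  have h0 : quadricSign q 0 = 1 := by rw [quadricSign, pow_zero, map_one]
  have hrow : ∀ v, rowMap (Λ.powGen e) v 0 =
      Λ.param ^ e * (Λ.factor (quadricSign q 0)).mulVec v 1 := by
    intro v
    rw [rowMap_apply, Fin.sum_univ_two, factor_mulVec_one, h0]
    simp only [powGen, Matrix.cons_val_zero, Matrix.cons_val_one, Matrix.cons_val_fin_one]
    ring
  intro v
  constructor
  · intro h
    have h1 := congrFun h 0
    rw [hrow, factor_mulVec_one] at h1
    exact Λ.exists_factor_mulVec_eq (quadricSign_mul_self 0) (quadricSign_add_succ 0) v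
      ((mem_nonZeroDivisors_iff.1 (Λ.pow_mem_nonZeroDivisors e)).1 _ h1)
  · rintro ⟨u, rfl⟩
    funext b
    rw [Subsingleton.elim b 0, hrow, Matrix.mulVecLin_apply,
      Λ.factor_mulVec_factor (quadricSign_mul_self 0) (quadricSign_add_succ 0)]
    exact mul_zero _

theorem exact_factor_factor (n : ℕ) :
    Function.Exact (Λ.factor (quadricSign q (n + 1))).mulVecLin
      (Λ.factor (quadricSign q n)).mulVecLin := by
  intro v
  constructor
  · intro h
    have h1 := congrFun h 1
    rw [Matrix.mulVecLin_apply, factor_mulVec_one] at h1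
    exact Λ.exists_factor_mulVec_eq (quadricSign_mul_self n) (quadricSign_add_succ n) v h1
  · rintro ⟨u, rfl⟩
    exact Λ.factor_mulVec_factor (quadricSign_mul_self n) (quadricSign_add_succ n) u

/-- The linear resolution of `(R/I)(-d)`, where `I = param ^ e • ⟨param, gen⟩`. -/
noncomputable def linearResolution (hq : q.IsHomogeneous 2) (d : ℤ) (e : ℕ) :
    MinimalResolution (cyclicMod hq (T := Set.range (Λ.powGen e))
      (by rintro _ ⟨a, rfl⟩; exact ⟨_, Λ.powGen_mem e a⟩) d) where
  rank i := match i with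
    | 0 => 1
    | _ + 1 => 2
  deg i _ := match i with
    | 0 => d
    | i + 1 => d + (e + 1) + i
  aug := cyclicAug (Ideal.span (Set.range (Λ.powGen e)))
  diff i := match i with
    | 0 => rowMap (Λ.powGen e)
    | i + 1 => (Λ.factor (quadricSign q (i + 1))).mulVecLin
  aug_homogeneous := cyclicAug_single_mem _ d
  diff_homogeneous i a b := match i with
    | 0 => by
      change rowMap (Λ.powGen e) (Pi.single a 1) b ∈ gradedPiece q (d + (e + 1) + (0 : ℕ) - d)
      rw [rowMap_single, Nat.cast_zero, add_zero, add_sub_cancel_left]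
      exact Λ.powGen_mem e a
    | i + 1 => by
      change (Λ.factor (quadricSign q (i + 1))).mulVecLin (Pi.single a 1) b ∈
        gradedPiece q (d + (e + 1) + (i + 1 : ℕ) - (d + (e + 1) + i))
      rw [Matrix.mulVecLin_apply, Matrix.mulVec_single_one, Nat.cast_succ, add_sub_add_left_eq_sub,
        add_sub_cancel_left]
      exact Λ.factor_mem_gradedPiece (i + 1) a b
  aug_surjective := cyclicAug_surjective _
  exact_zero := exact_rowMap _
  exact_succ i := match i with
    | 0 => Λ.exact_factor_rowMap e
    | i + 1 => Λ.exact_factor_factor (i + 1)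
  minimal i a b := match i with
    | 0 => by
      change rowMap (Λ.powGen e) (Pi.single a 1) b ∈ _
      rw [rowMap_single]
      exact Λ.powGen_mem_irrelevantIdeal e a
    | i + 1 => by
      change (Λ.factor (quadricSign q (i + 1))).mulVecLin (Pi.single a 1) b ∈ _
      rw [Matrix.mulVecLin_apply, Matrix.mulVec_single_one]
      exact gradedPiece_one_le _ (Λ.factor_mem_gradedPiece (i + 1) a b)

end LinearParameter

end MatrixFactorization

/-! ### Betti diagrams of modules of the two kinds -/

namespace MinimalResolution

variable {k : Type u} [Field k] {q : MvPolynomial (Fin 2) k} {M : GradedMod q}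
  (F : MinimalResolution M)

theorem cumul_betti (i : ℕ) (n : ℤ) :
    cumul n (F.betti i) = Fintype.card {a : Fin (F.rank i) // F.deg i a < n} := by
  rw [betti, map_sum, Fintype.card_subtype, ← Finset.sum_boole]
  exact Finset.sum_congr rfl fun a _ => cumul_single _ _ _

theorem betti_mem_diagramCone (Λ : LinearParameter q) : F.betti ∈ diagramCone := by
  refine mem_diagramCone.2 ⟨F.betti_nonneg, F.betti_succ_le Λ 0, F.betti_succ_eq Λ, fun n => ?_⟩
  have h := F.two_mul_card_le Λ n
  simp only [cumul_betti, ← Int.lt_add_one_iff] at h ⊢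
  rw [add_assoc, one_add_one_eq_two] at h
  exact_mod_cast h

variable {F}

theorem IsPure.betti_eq {d : ℕ → WithTop ℤ} (h : F.IsPure d) {i : ℕ} {j : ℤ} (hi : d i = j) :
    F.betti i = Finsupp.single j (F.rank i : ℚ) := by
  have : ∀ a, Finsupp.single (F.deg i a) (1 : ℚ) = Finsupp.single j 1 := fun a => by
    rw [WithTop.coe_injective ((h.1 i a).trans hi)]
  rw [betti, Finset.sum_congr rfl fun a _ => this a, Finset.sum_const, Finset.card_univ,
    Fintype.card_fin, Finsupp.smul_single, nsmul_one]

theorem IsPure.betti_eq_zero {d : ℕ → WithTop ℤ} (h : F.IsPure d) {i : ℕ} (hi : d i = ⊤) :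
    F.betti i = 0 := by
  have h0 := (h.2 i).2 hi
  ext j
  rw [betti_apply, Finsupp.zero_apply, Nat.cast_eq_zero, Fintype.card_eq_zero_iff]
  exact ⟨fun a => (Fin.cast h0 a.1).elim0⟩

end MinimalResolution

section Kinds

variable {k : Type u} [Field k] {q : MvPolynomial (Fin 2) k} {M : GradedMod q}
  {F : MinimalResolution M}

/-- For finite `d₁` the depth is zero, so the Cohen–Macaulay condition gives dimension zero and
therefore equally many generators and relations. -/
theorem IsFirstKind.ray_betti {d₀ : ℤ} {d₁ : WithTop ℤ} (h : IsFirstKind F d₀ d₁)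
    (Λ : LinearParameter q) : ray F.betti = ray (finiteDiagram d₀ d₁) := by
  have hr0 : F.rank 0 ≠ 0 := fun h0 => WithTop.coe_ne_top ((h.pure.2 0).1 h0)
  have hr2 : F.rank 2 = 0 := (h.pure.2 2).2 rfl
  have hb : F.betti = (F.rank 0 : ℚ) • finiteDiagram d₀ d₁ := by
    funext i
    rcases i with _ | _ | i
    · rw [h.pure.betti_eq (i := 0) rfl]
      simp [finiteDiagram]
    · cases d₁ with
      | top =>
        rw [h.pure.betti_eq_zero (i := 0 + 1) rfl]
        simp [finiteDiagram]
      | coe d =>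
        have hr1 : F.rank 1 ≠ 0 := fun h1 => WithTop.coe_ne_top ((h.pure.2 1).1 h1)
        have hdim : Module.supportDim (QuadricRing q) M.carrier ≤ 0 := by
          have := h.cohenMacaulay
          rw [GradedMod.IsCohenMacaulay, F.depth_eq_zero Λ hr1 hr2] at this
          rw [← this]
          rfl
        rw [h.pure.betti_eq (i := 0 + 1) (j := d) rfl, zero_add,
          ← F.rank_zero_eq_rank_one Λ hdim hr2]
        simp [finiteDiagram]
    · rw [h.pure.betti_eq_zero (i := i + 2) rfl]
      simp [finiteDiagram]
  rw [hb, ray_smul (by positivity)]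

theorem IsSecondKind.betti_succ {d₀ d₁ : ℤ} (h : IsSecondKind F d₀ d₁) (i : ℕ) :
    F.betti (i + 1) = Finsupp.single (d₁ + i) (F.rank (i + 1) : ℚ) :=
  h.pure.betti_eq (i := i + 1) rfl

theorem IsSecondKind.rank_ne_zero {d₀ d₁ : ℤ} (h : IsSecondKind F d₀ d₁) (i : ℕ) :
    F.rank i ≠ 0 := by
  intro h0
  have := (h.pure.2 i).1 h0
  cases i <;> exact WithTop.coe_ne_top this

/-- With `β₁ = 2β₀` the rank inequality becomes `β₁ ≤ β₂`; together with `β₂ ≤ β₁` this gives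
equality, which then persists in all later columns. -/
theorem IsSecondKind.ray_betti {d₀ d₁ : ℤ} (h : IsSecondKind F d₀ d₁) (Λ : LinearParameter q)
    (hb : F.betti 1 d₁ = 2 * F.betti 0 d₀) : ray F.betti = ray (infiniteDiagram d₀ d₁) := by
  have hb0 : F.betti 0 = Finsupp.single d₀ (F.rank 0 : ℚ) := h.pure.betti_eq (i := 0) rfl
  have hb1 : F.betti 1 = Finsupp.single d₁ (F.rank 1 : ℚ) := h.pure.betti_eq (i := 1) (by
    change ((d₁ + (0 : ℕ) : ℤ) : WithTop ℤ) = _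
    simp)
  have hb2 : F.betti 2 = Finsupp.single (d₁ + 1) (F.rank 2 : ℚ) := by
    have := h.betti_succ 1
    rwa [Nat.cast_one] at this
  obtain ⟨-, h2, h3, h4⟩ := mem_diagramCone.1 (F.betti_mem_diagramCone Λ)
  have a1 := h4 d₁
  have a2 := h2 d₁
  rw [hb0, hb1, hb2, cumul_single, cumul_single, cumul_single, if_pos (by omega), if_pos h.lt,
    if_pos (by omega)] at a1
  rw [hb1, hb2, Finsupp.single_eq_same, Finsupp.single_eq_same] at a2
  rw [hb0, hb1, Finsupp.single_eq_same, Finsupp.single_eq_same] at hb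
  have hrank : ∀ i, (F.rank (i + 1) : ℚ) = F.rank 0 * 2 := by
    intro i
    induction i with
    | zero => rw [zero_add, hb, mul_comm]
    | succ i ih =>
      rcases i with _ | i
      · change (F.rank 2 : ℚ) = _
        linarith
      · rw [← ih]
        have h5 := h3 i (d₁ + (i + 1 : ℕ))
        rw [h.betti_succ (i + 1), h.betti_succ (i + 2), Finsupp.single_eq_same,
          show d₁ + ((i + 1 : ℕ) : ℤ) + 1 = d₁ + (i + 2 : ℕ) by push_cast; ring,
          Finsupp.single_eq_same] at h5
        exact h5
  have hbe : F.betti = (F.rank 0 : ℚ) • infiniteDiagram d₀ d₁ := by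
    funext i
    rcases i with _ | i
    · rw [hb0]
      simp [infiniteDiagram]
    · rw [h.betti_succ, hrank]
      simp [infiniteDiagram]
  have hr0 := h.rank_ne_zero 0
  rw [hbe, ray_smul (by positivity)]

end Kinds

/-! ### Realization of all degree sequences and the final comparison -/

section Existence

variable {k : Type u} [Field k] {q : MvPolynomial (Fin 2) k}

theorem LinearParameter.nontrivial_quotient (Λ : LinearParameter q) {T : Set (QuadricRing q)}
    (hT : ∀ t ∈ T, t ∈ irrelevantIdeal q) : Nontrivial (QuadricRing q ⧸ Ideal.span T) := by
  rw [Ideal.Quotient.nontrivial_iff, Ne, Ideal.eq_top_iff_one]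
  intro h
  have h1 := Λ.fst_red_of_mem_irrelevantIdeal (Ideal.span_le.2 hT h)
  rw [map_one, TrivSqZeroExt.fst_one] at h1
  exact one_ne_zero h1

theorem GradedMod.isCohenMacaulay_of_supportDim_le (M : GradedMod q) [Nontrivial M.carrier]
    (h : Module.supportDim (QuadricRing q) M.carrier ≤ M.depth) : M.IsCohenMacaulay :=
  le_antisymm M.depth_le_supportDim h

theorem isFirstKind_freeResolution (hq : q.IsHomogeneous 2) (hq0 : q ≠ 0) (Λ : LinearParameter q)
    (d : ℤ) : IsFirstKind (freeResolution hq d) d ⊤ := by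
  refine ⟨WithTop.coe_lt_top d, ?_, (freeResolution hq d).hasFiniteProjDim rfl, ?_, ?_⟩
  · let T := Set.range (Fin.elim0 : Fin 0 → QuadricRing q)
    have hT : T = ∅ := Set.range_eq_empty _
    have hbot : ∀ r, r ∈ Ideal.span T ↔ r = 0 := fun r => by
      rw [hT, Ideal.span_empty, Ideal.mem_bot]
    have hnt : Nontrivial (QuadricRing q ⧸ Ideal.span T) :=
      Λ.nontrivial_quotient (by rintro _ ⟨a, -⟩; exact a.elim0)
    have : Nontrivial (cyclicMod hq (T := T) (by rintro _ ⟨a, -⟩; exact a.elim0) d).carrier := hnt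
    refine GradedMod.isCohenMacaulay_of_supportDim_le _ ?_
    -- The dimension is at most one, and `l` alone is a regular sequence of length one.
    refine ((Module.supportDim_le_ringKrullDim _ _).trans (ringKrullDim_quadricRing_le hq0)).trans ?_
    have hreg : RingTheory.Sequence.IsRegular (QuadricRing q ⧸ Ideal.span T) [Λ.param] := by
      have hsub : Nontrivial (QuotSMulTop Λ.param (QuadricRing q ⧸ Ideal.span T)) := by
        rw [Submodule.Quotient.nontrivial_iff, Ne, Submodule.eq_top_iff']
        intro h
        obtain ⟨y, -, hy⟩ := (Submodule.mem_smul_pointwise_iff_exists _ _ _).1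
          (h (Ideal.Quotient.mk _ 1))
        obtain ⟨r, rfl⟩ := Ideal.Quotient.mk_surjective y
        have h1 : Ideal.Quotient.mk (Ideal.span T) (Λ.param * r) = Ideal.Quotient.mk _ 1 := hy
        rw [Ideal.Quotient.eq, hbot, sub_eq_zero] at h1
        have h2 := congrArg Λ.red h1
        rw [map_mul, Λ.red_param, zero_mul, map_one] at h2
        exact zero_ne_one h2
      refine (RingTheory.Sequence.isRegular_cons_iff _ _ _).2 ⟨?_, RingTheory.Sequence.IsRegular.nil _ _⟩
      rw [isSMulRegular_iff_right_eq_zero_of_smul]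
      intro y hy
      obtain ⟨r, rfl⟩ := Ideal.Quotient.mk_surjective y
      have h1 : Ideal.Quotient.mk (Ideal.span T) (Λ.param * r) = 0 := hy
      rw [Ideal.Quotient.eq_zero_iff_mem, hbot] at h1
      rw [Λ.eq_zero_of_param_mul r h1, map_zero]
    refine WithBot.coe_le_coe.2 ?_
    refine le_iSup_of_le [Λ.param] (le_iSup_of_le ?_ (le_iSup_of_le hreg ?_))
    · intro r hr
      rw [List.mem_singleton.1 hr]
      exact gradedPiece_one_le _ Λ.param_mem
    · simp
  · rintro (_ | i) a
    · rfl
    · exact a.elim0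
  · rintro (_ | _ | i)
    · exact ⟨fun h => absurd h one_ne_zero, fun h => absurd h WithTop.coe_ne_top⟩
    · exact ⟨fun _ => rfl, fun _ => rfl⟩
    · exact ⟨fun _ => rfl, fun _ => rfl⟩

theorem exists_isFirstKind_coe (hq : q.IsHomogeneous 2) (hq0 : q ≠ 0) (Λ : LinearParameter q)
    {d₀ d₁ : ℤ} (hlt : d₀ < d₁) :
    ∃ (M : GradedMod q) (F : MinimalResolution M), IsFirstKind F d₀ d₁ := by
  obtain ⟨e, he⟩ := Int.eq_ofNat_of_zero_le (sub_nonneg.2 hlt.le)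
  have he0 : e ≠ 0 := by omega
  obtain rfl : d₁ = d₀ + e := by omega
  have hm : Λ.param ^ e ∈ irrelevantIdeal q :=
    Ideal.pow_mem_of_mem _ (gradedPiece_one_le _ Λ.param_mem) e (Nat.pos_of_ne_zero he0)
  let F := principalResolution hq d₀ (pow_mem_gradedPiece Λ.param_mem e)
    (Λ.pow_mem_nonZeroDivisors e) hm
  refine ⟨_, F, WithTop.coe_lt_coe.2 hlt, ?_, F.hasFiniteProjDim rfl, ?_, ?_⟩
  · have : Nontrivial (cyclicMod hq (T := Set.range fun _ : Fin 1 => Λ.param ^ e)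
        (by rintro _ ⟨a, rfl⟩; exact ⟨e, pow_mem_gradedPiece Λ.param_mem e⟩) d₀).carrier :=
      Λ.nontrivial_quotient (by rintro _ ⟨a, rfl⟩; exact hm)
    refine GradedMod.isCohenMacaulay_of_supportDim_le _ (le_trans ?_ (WithBot.coe_le_coe.2 zero_le))
    refine le_trans (le_of_eq (Module.supportDim_quotient_eq_ringKrullDim _)) ?_
    exact Λ.ringKrullDim_quotient_le hq0 (Ideal.subset_span ⟨0, rfl⟩)
  · rintro (_ | _ | i) a
    · rfl
    · rfl
    · exact a.elim0
  · rintro (_ | _ | i)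
    · exact ⟨fun h => absurd h one_ne_zero, fun h => absurd h WithTop.coe_ne_top⟩
    · exact ⟨fun h => absurd h one_ne_zero, fun h => absurd h WithTop.coe_ne_top⟩
    · exact ⟨fun _ => rfl, fun _ => rfl⟩

theorem exists_isFirstKind (hq : q.IsHomogeneous 2) (hq0 : q ≠ 0) (Λ : LinearParameter q)
    (d₀ : ℤ) (d₁ : WithTop ℤ) (hlt : (d₀ : WithTop ℤ) < d₁) :
    ∃ (M : GradedMod q) (F : MinimalResolution M), IsFirstKind F d₀ d₁ := by
  cases d₁ with
  | top => exact ⟨_, _, isFirstKind_freeResolution hq hq0 Λ d₀⟩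
  | coe d => exact exists_isFirstKind_coe hq hq0 Λ (WithTop.coe_lt_coe.1 hlt)

theorem isFiniteLength_quotient_of_ringKrullDim_le {R : Type*} [CommRing R] [IsNoetherianRing R]
    {I : Ideal R} (h : ringKrullDim (R ⧸ I) ≤ 0) : IsFiniteLength R (R ⧸ I) := by
  have hart : IsArtinianRing (R ⧸ I) := isArtinianRing_of_ringKrullDim_le h
  rw [isFiniteLength_iff_isNoetherian_isArtinian]
  exact ⟨inferInstance, isArtinian_of_surjective_algebraMap
    (R := R ⧸ I) (S := R) (M := R ⧸ I) Ideal.Quotient.mk_surjective⟩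

theorem exists_isSecondKind (hq : q.IsHomogeneous 2) (hq0 : q ≠ 0) (Λ : LinearParameter q)
    (d₀ d₁ : ℤ) (hlt : d₀ < d₁) : ∃ (M : GradedMod q) (F : MinimalResolution M),
      IsSecondKind F d₀ d₁ ∧ F.betti 1 d₁ = 2 * F.betti 0 d₀ := by
  obtain ⟨e, he⟩ := Int.eq_ofNat_of_zero_le (sub_nonneg.2 (Int.add_one_le_of_lt hlt))
  obtain rfl : d₁ = d₀ + (e + 1) := by omega
  let F := Λ.linearResolution hq d₀ e
  have hpure : F.IsPure (infiniteType d₀ (d₀ + (e + 1))) := by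
    constructor
    · rintro (_ | i) a
      · rfl
      · rfl
    · rintro (_ | i)
      · exact ⟨fun h => absurd h one_ne_zero, fun h => absurd h WithTop.coe_ne_top⟩
      · exact ⟨fun h => absurd h two_ne_zero, fun h => absurd h WithTop.coe_ne_top⟩
  have hpow : Λ.param ^ (e + 1) ∈ Ideal.span (Set.range (Λ.powGen e)) := by
    refine Ideal.subset_span ⟨0, ?_⟩
    rw [LinearParameter.powGen, Matrix.cons_val_zero, pow_succ]
  have hF : IsSecondKind F d₀ (d₀ + (e + 1)) := by
    refine ⟨hlt, ?_, F.not_hasFiniteProjDim Λ ?_, hpure⟩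
    · exact isFiniteLength_quotient_of_ringKrullDim_le (Λ.ringKrullDim_quotient_le hq0 hpow)
    · rintro (_ | i)
      · exact one_ne_zero
      · exact two_ne_zero
  refine ⟨_, F, hF, ?_⟩
  have h1 := hF.betti_succ 0
  rw [Nat.cast_zero, add_zero] at h1
  rw [h1, hpure.betti_eq (i := 0) rfl, Finsupp.single_eq_same, Finsupp.single_eq_same]
  change ((2 : ℕ) : ℚ) = 2 * ((1 : ℕ) : ℚ)
  norm_num

/-- One inclusion is the validity of the inequalities; the other holds because the pure diagrams
generating `diagramCone` are positive multiples of Betti diagrams. -/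
theorem bettiCone_eq_diagramCone (hq : q.IsHomogeneous 2) (hq0 : q ≠ 0) :
    bettiCone q = diagramCone := by
  obtain ⟨Λ⟩ := exists_linearParameter hq hq0
  refine le_antisymm (Submodule.span_le.2 ?_) ?_
  · rintro _ ⟨M, F, rfl⟩
    exact F.betti_mem_diagramCone Λ
  · rw [← hull_pureDiagrams]
    have hmem : ∀ {M : GradedMod q} (F : MinimalResolution M) {v}, ray F.betti = ray v →
        v ∈ bettiCone q := by
      intro M F v h
      have hv : v ∈ ray F.betti := h ▸ mem_ray.2 ⟨1, zero_le_one, (one_smul _ _).symm⟩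
      obtain ⟨c, hc, rfl⟩ := mem_ray.1 hv
      exact (bettiCone q).smul_mem hc (PointedCone.subset_hull ⟨M, F, rfl⟩)
    refine Submodule.span_le.2 ?_
    rintro v (⟨d₀, d₁, hlt, rfl⟩ | ⟨d₀, d₁, hlt, rfl⟩)
    · obtain ⟨M, F, hF⟩ := exists_isFirstKind hq hq0 Λ d₀ d₁ hlt
      exact hmem F (hF.ray_betti Λ)
    · obtain ⟨M, F, hF, hb⟩ := exists_isSecondKind hq hq0 Λ d₀ d₁ hlt
      exact hmem F (hF.ray_betti Λ hb)

theorem isExtremalRay_bettiCone_iff (hq : q.IsHomogeneous 2) (hq0 : q ≠ 0)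
    {ρ : PointedCone ℚ DiagramSpace} :
    IsExtremalRay (bettiCone q) ρ ↔ ∃ v ∈ pureDiagrams, ρ = ray v := by
  rw [bettiCone_eq_diagramCone hq hq0]
  constructor
  · intro h
    rw [← hull_pureDiagrams] at h
    exact h.exists_generator
  · rintro ⟨v, hv, rfl⟩
    exact isExtremalRay_of_mem_pureDiagrams hv

end Existence

theorem theorem1p2 {k : Type u} [Field k] (q : MvPolynomial (Fin 2) k)
    (hq : q.IsHomogeneous 2) (hq0 : q ≠ 0) :
    -- the extremal rays are spanned by the two kinds of diagrams
    (∀ ρ : PointedCone ℚ DiagramSpace, IsExtremalRay (bettiCone q) ρ ↔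
      (∃ (M : GradedMod q) (F : MinimalResolution M) (d₀ : ℤ) (d₁ : WithTop ℤ),
        IsFirstKind F d₀ d₁ ∧ ρ = ray F.betti) ∨
      (∃ (M : GradedMod q) (F : MinimalResolution M) (d₀ d₁ : ℤ),
        IsSecondKind F d₀ d₁ ∧ F.betti 1 d₁ = 2 * F.betti 0 d₀ ∧ ρ = ray F.betti)) ∧
    -- the numerical condition on modules of the second kind is also necessary
    (∀ (M : GradedMod q) (F : MinimalResolution M) (d₀ d₁ : ℤ), IsSecondKind F d₀ d₁ →
      IsExtremalRay (bettiCone q) (ray F.betti) → F.betti 1 d₁ = 2 * F.betti 0 d₀) ∧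
    -- every degree sequence of either form occurs
    (∀ (d₀ : ℤ) (d₁ : WithTop ℤ), (d₀ : WithTop ℤ) < d₁ →
      ∃ (M : GradedMod q) (F : MinimalResolution M), IsFirstKind F d₀ d₁) ∧
    (∀ d₀ d₁ : ℤ, d₀ < d₁ → ∃ (M : GradedMod q) (F : MinimalResolution M),
      IsSecondKind F d₀ d₁ ∧ F.betti 1 d₁ = 2 * F.betti 0 d₀) ∧
    -- the cone is generated by its extremal rays
    PointedCone.hull ℚ {v | ∃ ρ, IsExtremalRay (bettiCone q) ρ ∧ v ∈ ρ} = bettiCone q := by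
  obtain ⟨Λ⟩ := exists_linearParameter hq hq0
  have hray : ∀ v : DiagramSpace, v ∈ ray v := fun v =>
    mem_ray.2 ⟨1, zero_le_one, (one_smul _ _).symm⟩
  refine ⟨fun ρ => ?_, fun M F d₀ d₁ hF hext => ?_, exists_isFirstKind hq hq0 Λ,
    exists_isSecondKind hq hq0 Λ, le_antisymm (Submodule.span_le.2 ?_) ?_⟩
  · rw [isExtremalRay_bettiCone_iff hq hq0]
    constructor
    · rintro ⟨v, ⟨d₀, d₁, hlt, rfl⟩ | ⟨d₀, d₁, hlt, rfl⟩, rfl⟩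
      · obtain ⟨M, F, hF⟩ := exists_isFirstKind hq hq0 Λ d₀ d₁ hlt
        exact Or.inl ⟨M, F, d₀, d₁, hF, (hF.ray_betti Λ).symm⟩
      · obtain ⟨M, F, hF, hb⟩ := exists_isSecondKind hq hq0 Λ d₀ d₁ hlt
        exact Or.inr ⟨M, F, d₀, d₁, hF, hb, (hF.ray_betti Λ hb).symm⟩
    · rintro (⟨M, F, d₀, d₁, hF, rfl⟩ | ⟨M, F, d₀, d₁, hF, hb, rfl⟩)
      · exact ⟨_, Or.inl ⟨d₀, d₁, hF.lt, rfl⟩, hF.ray_betti Λ⟩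
      · exact ⟨_, Or.inr ⟨d₀, d₁, hF.lt, rfl⟩, hF.ray_betti Λ hb⟩
  · obtain ⟨v, hv, hv'⟩ := (isExtremalRay_bettiCone_iff hq hq0).1 hext
    obtain ⟨c, -, hc⟩ := mem_ray.1 (hv' ▸ hray F.betti)
    have hne : ∀ i, (F.rank i : ℚ) ≠ 0 := fun i => Nat.cast_ne_zero.2 (hF.rank_ne_zero i)
    have hb0 : F.betti 0 d₀ ≠ 0 := by
      rw [hF.pure.betti_eq (i := 0) rfl, Finsupp.single_eq_same]
      exact hne 0
    have hb : ∀ i : ℕ, F.betti (i + 1) (d₁ + i) ≠ 0 := by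
      intro i
      rw [hF.betti_succ, Finsupp.single_eq_same]
      exact hne _
    -- A finite pure diagram is excluded because column 2 of a module of the second kind is nonzero;
    -- on an infinite one the ratio of columns 1 and 0 is two.
    rcases hv with ⟨e₀, e₁, -, rfl⟩ | ⟨e₀, e₁, -, rfl⟩
    · refine absurd ?_ (hb 1)
      rw [hc]
      simp [finiteDiagram]
    · have hb1 := hb 0
      rw [Nat.cast_zero, add_zero, zero_add] at hb1
      rw [hc] at hb0 hb1 ⊢
      simp only [Pi.smul_apply, infiniteDiagram, Finsupp.smul_apply, Finsupp.single_apply,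
        smul_eq_mul, Nat.cast_zero, add_zero] at hb0 hb1 ⊢
      split_ifs at hb0 hb1 ⊢ with h1 h2
      · ring
      all_goals simp at hb0 hb1
  · rintro v ⟨ρ, hρ, hv⟩
    exact hρ.2.le hv
  · rw [bettiCone_eq_diagramCone hq hq0, ← hull_pureDiagrams]
    refine Submodule.span_le.2 fun v hv => PointedCone.subset_hull ⟨ray v, ?_, hray v⟩
    rw [hull_pureDiagrams]
    exact isExtremalRay_of_mem_pureDiagrams hv
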